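/- For $0\le k\le n$ let $G(n,k)$ be the Grassmannian of $k$-dimensional linear subspaces of Euclidean space $\mathbb R^n$, and let $dg$ be its $O_n(\mathbb R)$-invariant Borel probability measure (the image of the Haar probability measure of $O_n(\mathbb R)$ under $U\mapsto Ug_0$, for any $g_0\in G(n,k)$). For $A\in GL_n(\mathbb R)$ and $g\in G(n,k)$ write $A_\#g=A(g)\in G(n,k)$, and let $|\det A|_g|$ be the modulus of the determinant of the linear map $A|_g\colon g\to A(g)$ with respect to orthonormal bases of $g$ and $A(g)$, i.e. $|\det A|_g|=\sqrt{\det\big((A|_g)^{T}(A|_g)\big)}$. Put $\log^+x=\max(0,\log x)$. A Borel measure $\mu$ on $GL_n(\mathbb R)$ is called orthogonally invariant if it is invariant under left multiplication $A\mapsto UA$ by every $U\in O_n(\mathbb R)$. **Theorem.** For every $n$ there is a constant $c_n>0$, depending only on $n$, such that for every $0\le k\le n$ and every orthogonally invariant Borel probability measure $\mu$ on $GL_n(\mathbb R)$, $$ \int_{GL_n(\mathbb R)}\Big[\sup_{\substack{g\in G(n,k)\\ A_\#g=g}}\log^+|\det A|_g|\Big]\,d\mu(A)\;\ge\; c_n\int_{GL_n(\mathbb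 R)}\int_{G(n,k)}\log^+|\det A|_g|\,dg\,d\mu(A), $$ where the supremum is $0$ if no $g\in G(n,k)$ satisfies $A_\#g=g$, and both sides are taken in $[0,\infty]$. -/

import Mathlib

open MeasureTheory Matrix Real
open scoped ENNReal NNReal

noncomputable section

namespace OrthInv

/-- `ℝⁿ` with its Euclidean structure. -/
abbrev E (n : ℕ) : Type := EuclideanSpace ℝ (Fin n)

/-- The orthogonal group `O_n(ℝ)`. -/
abbrev O (n : ℕ) : Type := Matrix.orthogonalGroup (Fin n) ℝ

/-- `GL_n(ℝ)` carries its Borel σ-algebra. -/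
instance instMeasurableSpaceGL (n : ℕ) : MeasurableSpace (GL (Fin n) ℝ) := borel _

instance instBorelSpaceGL (n : ℕ) : BorelSpace (GL (Fin n) ℝ) := ⟨rfl⟩

/-- `O_n(ℝ)` carries its Borel σ-algebra. -/
instance instMeasurableSpaceO (n : ℕ) : MeasurableSpace (O n) := borel _

instance instBorelSpaceO (n : ℕ) : BorelSpace (O n) := ⟨rfl⟩

instance instCompactSpaceO (n : ℕ) : CompactSpace (O n) := by
  have hc : IsCompact (Set.pi Set.univ fun _ : Fin n =>
      Set.pi Set.univ fun _ : Fin n => Metric.closedBall (0 : ℝ) 1) :=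
    isCompact_univ_pi fun _ => isCompact_univ_pi fun _ => isCompact_closedBall _ _
  have hcl : IsClosed ((Matrix.orthogonalGroup (Fin n) ℝ : Submonoid (Matrix (Fin n) (Fin n) ℝ)) :
      Set (Matrix (Fin n) (Fin n) ℝ)) := by
    have h : ((Matrix.orthogonalGroup (Fin n) ℝ : Submonoid (Matrix (Fin n) (Fin n) ℝ)) :
        Set (Matrix (Fin n) (Fin n) ℝ)) = {M | M * star M = 1} := by
      ext M; exact Matrix.mem_orthogonalGroup_iff (Fin n) ℝ
    rw [h]
    exact isClosed_eq (by fun_prop) continuous_const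
  refine isCompact_iff_compactSpace.mp (IsCompact.of_isClosed_subset hc hcl ?_)
  intro M hM i _ j _
  simpa using entry_norm_bound_of_unitary hM i j

/-- The inclusion `O_n(ℝ) ⊆ GL_n(ℝ)`. -/
def O.toGL {n : ℕ} : O n →* GL (Fin n) ℝ := Unitary.toUnits

/-- The linear automorphism `x ↦ A x` of `ℝⁿ`, as a linear map. -/
def euclMap {n : ℕ} (A : GL (Fin n) ℝ) : E n →ₗ[ℝ] E n :=
  (Matrix.toEuclideanCLM (𝕜 := ℝ) (A : Matrix (Fin n) (Fin n) ℝ) : E n →L[ℝ] E n)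

lemma euclMap_one {n : ℕ} : euclMap (1 : GL (Fin n) ℝ) = LinearMap.id := by
  ext; simp [euclMap]

lemma euclMap_mul {n : ℕ} (A B : GL (Fin n) ℝ) : euclMap (A * B) = euclMap A ∘ₗ euclMap B := by
  ext; simp [euclMap]

lemma euclMap_injective {n : ℕ} (A : GL (Fin n) ℝ) : Function.Injective (euclMap A) := by
  have h : euclMap A⁻¹ ∘ₗ euclMap A = LinearMap.id := by
    rw [← euclMap_mul, inv_mul_cancel, euclMap_one]
  intro x y hxy
  simpa [h] using (show (euclMap A⁻¹ ∘ₗ euclMap A) x = (euclMap A⁻¹ ∘ₗ euclMap A) y by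
    simp [hxy])

/-- The Grassmannian `G(n,k)` of `k`-dimensional linear subspaces of `ℝⁿ`. -/
def Grass (n k : ℕ) : Type := {g : Submodule ℝ (E n) // Module.finrank ℝ g = k}

/-- The natural action `A_# g = A(g)` of `GL_n(ℝ)` on `G(n,k)`. -/
instance instMulActionGrass (n k : ℕ) : MulAction (GL (Fin n) ℝ) (Grass n k) where
  smul A g := ⟨g.1.map (euclMap A),
    (LinearEquiv.finrank_eq
      (Submodule.equivMapOfInjective _ (euclMap_injective A) g.1)).symm.trans g.2⟩
  one_smul g := Subtype.ext (by
    change g.1.map (euclMap 1) = g.1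
    rw [euclMap_one, Submodule.map_id])
  mul_smul A B g := Subtype.ext (by
    change g.1.map (euclMap (A * B)) = (g.1.map (euclMap B)).map (euclMap A)
    rw [euclMap_mul, Submodule.map_comp])

/-- The usual topology of `G(n,k)`: a subspace is identified with the orthogonal projection
onto it. -/
instance instTopologicalSpaceGrass (n k : ℕ) : TopologicalSpace (Grass n k) :=
  TopologicalSpace.induced (fun g => g.1.starProjection) inferInstance

/-- `G(n,k)` carries its Borel σ-algebra. -/
instance instMeasurableSpaceGrass (n k : ℕ) : MeasurableSpace (Grass n k) := borel _

instance instBorelSpaceGrass (n k : ℕ) : BorelSpace (Grass n k) := ⟨rfl⟩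

/-- The coordinate subspace spanned by the first `k` standard basis vectors. -/
def Grass.base {n k : ℕ} (h : k ≤ n) : Grass n k :=
  ⟨Submodule.span ℝ (Set.range fun i : Fin k => EuclideanSpace.single (Fin.castLE h i) (1 : ℝ)), by
    have hli : LinearIndependent ℝ
        (fun i : Fin k => EuclideanSpace.single (Fin.castLE h i) (1 : ℝ)) := by
      have := (EuclideanSpace.basisFun (Fin n) ℝ).toBasis.linearIndependent.comp
        (Fin.castLE h) (Fin.castLE_injective h)
      simpa [Function.comp_def] using this
    simpa using finrank_span_eq_card hli⟩

/-- The Haar probability measure of `O_n(ℝ)`. -/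
def haarO (n : ℕ) : Measure (O n) := Measure.haarMeasure ⊤

instance instIsProbabilityMeasureHaarO (n : ℕ) : IsProbabilityMeasure (haarO n) :=
  ⟨by simpa [haarO] using Measure.haarMeasure_self (K₀ := (⊤ : TopologicalSpace.PositiveCompacts (O n)))⟩

/-- The orbit map of `O_n(ℝ)` on the Grassmannian is continuous. -/
lemma continuous_orbit {n k : ℕ} (g : Grass n k) :
    Continuous fun U : O n => O.toGL U • g := by
  refine continuous_induced_rng.mpr ?_
  have key : ∀ U : O n, (O.toGL U • g).1.starProjection =
      (Matrix.toEuclideanCLM (𝕜 := ℝ) (U : Matrix (Fin n) (Fin n) ℝ)) ∘L g.1.starProjection ∘L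
        (Matrix.toEuclideanCLM (𝕜 := ℝ) (star (U : Matrix (Fin n) (Fin n) ℝ))) := by
    intro U
    let V : unitary (E n →L[ℝ] E n) :=
      ⟨Matrix.toEuclideanCLM (𝕜 := ℝ) (U : Matrix (Fin n) (Fin n) ℝ),
        Unitary.map_mem (Matrix.toEuclideanCLM (𝕜 := ℝ) (n := Fin n)) U.2⟩
    let f : E n ≃ₗᵢ[ℝ] E n := Unitary.linearIsometryEquiv V
    have hmap : (O.toGL U • g).1 = g.1.map (f.toLinearEquiv : E n →ₗ[ℝ] E n) := rfl
    ext1 x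
    have h := Submodule.starProjection_map_apply f g.1 x
    have hs : f.symm x =
        Matrix.toEuclideanCLM (𝕜 := ℝ) (star (U : Matrix (Fin n) (Fin n) ℝ)) x := by
      rw [map_star]; rfl
    rw [hs] at h
    exact h
  have hc : Continuous fun M : Matrix (Fin n) (Fin n) ℝ => Matrix.toEuclideanCLM (𝕜 := ℝ) M :=
    LinearMap.continuous_of_finiteDimensional
      (Matrix.toEuclideanCLM (𝕜 := ℝ) (n := Fin n)).toAlgEquiv.toLinearMap
  have : ((fun g : Grass n k => g.1.starProjection) ∘ fun U : O n => O.toGL U • g) = fun U : O n =>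
      (Matrix.toEuclideanCLM (𝕜 := ℝ) (U : Matrix (Fin n) (Fin n) ℝ)) ∘L g.1.starProjection ∘L
        (Matrix.toEuclideanCLM (𝕜 := ℝ) (star (U : Matrix (Fin n) (Fin n) ℝ))) := funext key
  rw [this]
  exact (hc.comp continuous_subtype_val).clm_comp (continuous_const.clm_comp
    (hc.comp (continuous_star.comp continuous_subtype_val)))

/-- The `O_n(ℝ)`-invariant probability measure `dg` of `G(n,k)`, that is the image of the Haar
probability measure of `O_n(ℝ)` under the (transitive) action. -/
def grassMeasure {n k : ℕ} (h : k ≤ n) : Measure (Grass n k) :=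
  (haarO n).map fun U => O.toGL U • Grass.base h

instance instIsProbabilityMeasureGrass {n k : ℕ} (h : k ≤ n) :
    IsProbabilityMeasure (grassMeasure h) :=
  Measure.isProbabilityMeasure_map (continuous_orbit _).measurable.aemeasurable

/-- `|det A|_g|`: the factor by which `A` multiplies `k`-dimensional volume on `g`, that is the
modulus of the determinant of `A|_g : g → A(g)` in orthonormal bases of `g` and `A(g)`, written as
`√det((A|_g)ᵀ (A|_g))`. For `A(g) = g` it is the modulus of the determinant of the
endomorphism `A|_g` of `g`. -/
def absDet {n k : ℕ} (A : GL (Fin n) ℝ) (g : Grass n k) : ℝ :=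
  √(LinearMap.det (LinearMap.adjoint ((euclMap A).domRestrict g.1) ∘ₗ
    (euclMap A).domRestrict g.1))

/-- `log⁺ |det A|_g|`, as an element of `[0,∞]`. -/
def logPlusDet {n k : ℕ} (A : GL (Fin n) ℝ) (g : Grass n k) : ℝ≥0∞ :=
  ENNReal.ofReal (Real.posLog (absDet A g))

/-- A measure on `GL_n(ℝ)` is orthogonally invariant if it is invariant under left multiplication
by orthogonal matrices. -/
def IsOrthogonallyInvariant {n : ℕ} (μ : Measure (GL (Fin n) ℝ)) : Prop :=
  ∀ U : O n, μ.map (fun A => O.toGL U * A) = μ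

end OrthInv

end


/-!
Since `|det (U A)|_g| = |det A|_g|` for orthogonal `U`, orthogonal invariance and Fubini reduce the
inequality to a fixed `A`, averaged over `U A` with `U ∈ O_n(ℝ)`. Applying the layer-cake formula to
the open sets `Ω = {g | t < log⁺ |det A|_g|}`, it is enough to bound the measure of every open
`Ω ⊆ G(n,k)` by a constant times the Haar measure of `{U | U A fixes some g ∈ Ω}`.

Let `g₀ ∈ Ω`. By a block QR decomposition, `A` is `(1 + L) D` in suitable orthonormal frames of the
source and the target, the first adapted to `g₀`, with `L` strictly block upper triangular and `D`
diagonal and positive. When `U` is close to the reflection that is `1` on `g₀` and `-1` on `g₀ᗮ` in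
these frames, `U A` fixes a subspace close to `g₀`: writing this subspace as the image of `g₀` under
a shear `1 + X` turns the condition into a Riccati equation whose linear part is `X ↦ X + D X D⁻¹`.
The sign `+`, due to the reflection, makes its inverse bounded independently of `D`, so that how far
`U` may be from the reflection depends neither on `A` nor on `g₀`, except that `U` must move `g₀` by
at most `r / 16`, again in these frames, for a subspace within `r` of `g₀`.

The action of `U A` on the subspace so found is close to a positive diagonal matrix, the one on the
quotient to a negative diagonal matrix, and at most one subspace has this property. Subspaces `g₀`
with disjoint `r`-balls hence have disjoint sets of `U`; the measure of such a set is comparable to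
that of the `5 r`-ball around `g₀`, and the Vitali covering lemma gives the bound for `Ω`.
-/

noncomputable section

namespace OrthInv

section Frobenius

open scoped Matrix.Norms.Frobenius

variable {ι : Type*} [Fintype ι]

lemma frobenius_norm_sq_eq_trace (M : Matrix ι ι ℝ) : ‖M‖ ^ 2 = (star M * M).trace := by
  have h : 0 ≤ ∑ i, ∑ j, ‖M i j‖ ^ 2 := by positivity
  rw [frobenius_norm_def, ← Real.sqrt_eq_rpow]
  simp only [Real.rpow_ofNat]
  rw [Real.sq_sqrt h, Finset.sum_comm]
  simp [Matrix.trace, Matrix.mul_apply, sq]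

lemma frobenius_norm_le_of_abs_le {M N : Matrix ι ι ℝ} (h : ∀ i j, |M i j| ≤ |N i j|) :
    ‖M‖ ≤ ‖N‖ := by
  rw [frobenius_norm_def, frobenius_norm_def]
  simp only [Real.norm_eq_abs]
  gcongr (∑ i, ∑ j, ?_ ^ _) ^ _ with i _ j _
  exact h i j

lemma frobenius_norm_proj_mul_le {P : Matrix ι ι ℝ} (hP : IsStarProjection P)
    (M : Matrix ι ι ℝ) : ‖P * M‖ ≤ ‖M‖ := by
  classical
  have pythagoras : ‖M‖ ^ 2 = ‖P * M‖ ^ 2 + ‖(1 - P) * M‖ ^ 2 := by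
    simp only [frobenius_norm_sq_eq_trace, star_mul, hP.isSelfAdjoint.star_eq,
      hP.one_sub.isSelfAdjoint.star_eq]
    rw [← trace_add, mul_assoc, ← mul_assoc P, hP.isIdempotentElem.eq, mul_assoc,
      ← mul_assoc (1 - P), hP.one_sub.isIdempotentElem.eq, ← mul_add, ← add_mul,
      add_sub_cancel, one_mul]
  exact le_of_sq_le_sq (by linarith [sq_nonneg ‖(1 - P) * M‖]) (norm_nonneg _)

lemma frobenius_norm_mul_proj_le {P : Matrix ι ι ℝ} (hP : IsStarProjection P)
    (M : Matrix ι ι ℝ) : ‖M * P‖ ≤ ‖M‖ := by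
  rw [← norm_star, star_mul, hP.isSelfAdjoint.star_eq, ← norm_star M]
  exact frobenius_norm_proj_mul_le hP _

variable [DecidableEq ι]

lemma frobenius_norm_orthogonal_mul (U : orthogonalGroup ι ℝ) (M : Matrix ι ι ℝ) :
    ‖(U : Matrix ι ι ℝ) * M‖ = ‖M‖ := by
  rw [← sq_eq_sq₀ (norm_nonneg _) (norm_nonneg _), frobenius_norm_sq_eq_trace,
    frobenius_norm_sq_eq_trace, star_mul, mul_assoc, ← mul_assoc (star (U : Matrix ι ι ℝ)),
    Unitary.coe_star_mul_self, one_mul]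

lemma frobenius_norm_mul_orthogonal (M : Matrix ι ι ℝ) (U : orthogonalGroup ι ℝ) :
    ‖M * (U : Matrix ι ι ℝ)‖ = ‖M‖ := by
  rw [← norm_star, star_mul, ← Unitary.coe_star, frobenius_norm_orthogonal_mul, norm_star]

lemma frobenius_norm_proj_sub_proj_sq {P Q : Matrix ι ι ℝ} (hP : IsStarProjection P)
    (hQ : IsStarProjection Q) (h : P.trace = Q.trace) :
    ‖P - Q‖ ^ 2 = 2 * ‖(1 - P) * Q‖ ^ 2 := by
  have hPP := hP.isIdempotentElem.eq
  have hQQ := hQ.isIdempotentElem.eq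
  have left : ‖P - Q‖ ^ 2 = (P - P * Q - Q * P + Q).trace := by
    rw [frobenius_norm_sq_eq_trace, star_sub, hP.isSelfAdjoint.star_eq, hQ.isSelfAdjoint.star_eq]
    simp only [sub_mul, mul_sub, hPP, hQQ]
    congr 1
    abel
  have right : ‖(1 - P) * Q‖ ^ 2 = (Q - Q * P * Q).trace := by
    rw [frobenius_norm_sq_eq_trace, star_mul, hP.one_sub.isSelfAdjoint.star_eq,
      hQ.isSelfAdjoint.star_eq, mul_assoc, ← mul_assoc (1 - P), hP.one_sub.isIdempotentElem.eq,
      sub_mul, one_mul, mul_sub, hQQ, mul_assoc]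
  have cyclic : (Q * P * Q).trace = (P * Q).trace := by
    rw [trace_mul_comm, ← mul_assoc, hQQ, trace_mul_comm]
  rw [left, right]
  simp only [trace_sub, trace_add, cyclic, trace_mul_comm Q P, h]
  ring

lemma frobenius_norm_le_norm_add_diagonal_conj {s t : ι → ℝ} (hs : ∀ i, 0 < s i)
    (ht : ∀ i, 0 < t i) (Y : Matrix ι ι ℝ) : ‖Y‖ ≤ ‖Y + diagonal t * Y * diagonal s⁻¹‖ := by
  refine frobenius_norm_le_of_abs_le fun i j => ?_
  have one_le : 1 ≤ 1 + t i * (s j)⁻¹ :=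
    le_add_of_nonneg_right (mul_pos (ht i) (inv_pos.2 (hs j))).le
  have entry : (Y + diagonal t * Y * diagonal s⁻¹) i j = (1 + t i * (s j)⁻¹) * Y i j := by
    simp only [Matrix.add_apply, mul_diagonal, diagonal_mul, Pi.inv_apply]
    ring
  rw [entry, abs_mul, abs_of_pos (one_pos.trans_le one_le)]
  exact le_mul_of_one_le_left (abs_nonneg _) one_le

lemma diagonal_mul_diagonal_inv {s : ι → ℝ} (hs : ∀ i, 0 < s i) :
    diagonal s * diagonal s⁻¹ = 1 := by
  simp [diagonal_mul_diagonal, (hs _).ne']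

lemma diagonal_inv_mul_diagonal {s : ι → ℝ} (hs : ∀ i, 0 < s i) :
    diagonal s⁻¹ * diagonal s = 1 :=
  mul_eq_one_comm.1 (diagonal_mul_diagonal_inv hs)

lemma frobenius_norm_diagonal_conj_le_norm_add {s t : ι → ℝ} (hs : ∀ i, 0 < s i)
    (ht : ∀ i, 0 < t i) (Y : Matrix ι ι ℝ) :
    ‖diagonal t * Y * diagonal s⁻¹‖ ≤ ‖Y + diagonal t * Y * diagonal s⁻¹‖ := by
  have conj_back : diagonal t⁻¹ * (diagonal t * Y * diagonal s⁻¹) * diagonal s⁻¹⁻¹ = Y := by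
    simp only [inv_inv, mul_assoc, diagonal_inv_mul_diagonal hs, mul_one]
    rw [← mul_assoc, diagonal_inv_mul_diagonal ht, one_mul]
  have h := frobenius_norm_le_norm_add_diagonal_conj (s := s⁻¹) (t := t⁻¹)
    (fun i => inv_pos.2 (hs i)) (fun i => inv_pos.2 (ht i)) (diagonal t * Y * diagonal s⁻¹)
  rwa [conj_back, add_comm] at h

end Frobenius

section CoordProj

variable {ι : Type*} [DecidableEq ι] (p : ι → Prop) [DecidablePred p]

/-- The orthogonal projection of `ℝ^ι` onto the coordinate subspace spanned by the basis vectors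
whose index satisfies `p`. -/
def coordProj : Matrix ι ι ℝ := diagonal fun i => if p i then 1 else 0

variable [Fintype ι]

lemma isStarProjection_coordProj : IsStarProjection (coordProj p) where
  isIdempotentElem := by simp [IsIdempotentElem, coordProj]
  isSelfAdjoint := by simp [IsSelfAdjoint, coordProj, star_eq_conjTranspose]

lemma coordProj_mul_self : coordProj p * coordProj p = coordProj p :=
  (isStarProjection_coordProj p).isIdempotentElem.eq

lemma coordProj_mul_diagonal (s : ι → ℝ) :
    coordProj p * diagonal s = diagonal s * coordProj p := by
  simp [coordProj, mul_comm]

open scoped Matrix.Norms.Frobenius in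
lemma norm_corner_le (W : Matrix ι ι ℝ) : ‖(1 - coordProj p) * W * coordProj p‖ ≤ ‖W‖ :=
  (frobenius_norm_mul_proj_le (isStarProjection_coordProj p) _).trans
    (frobenius_norm_proj_mul_le (isStarProjection_coordProj p).one_sub _)

end CoordProj

section Riccati

open scoped Matrix.Norms.Frobenius

lemma exists_fixedPoint_of_half_lipschitz {V : Type*} [NormedAddCommGroup V] [CompleteSpace V]
    {f : V → V} {ρ : ℝ} (h0 : ‖f 0‖ ≤ ρ / 2)
    (hf : ∀ v w, ‖v‖ ≤ ρ → ‖w‖ ≤ ρ → ‖f v - f w‖ ≤ 1 / 2 * ‖v - w‖) :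
    ∃ v, ‖v‖ ≤ ρ ∧ f v = v := by
  have hρ : 0 ≤ ρ := by linarith [norm_nonneg (f 0)]
  have mapsTo : Set.MapsTo f (Metric.closedBall 0 ρ) (Metric.closedBall 0 ρ) := by
    intro v hv
    rw [mem_closedBall_zero_iff] at hv ⊢
    have h1 := hf v 0 hv (by simpa using hρ)
    rw [sub_zero] at h1
    linarith [norm_le_norm_sub_add (f v) (f 0)]
  have contracting : ContractingWith (1 / 2) (mapsTo.restrict f _ _) := by
    refine ⟨by rw [← NNReal.coe_lt_coe]; norm_num, LipschitzWith.of_dist_le_mul fun v w => ?_⟩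
    have := hf v w (mem_closedBall_zero_iff.1 v.2) (mem_closedBall_zero_iff.1 w.2)
    simpa [Subtype.dist_eq, dist_eq_norm] using this
  obtain ⟨v, hv, hfix, -⟩ := ContractingWith.exists_fixedPoint'
    Metric.isClosed_closedBall.isComplete mapsTo contracting (Metric.mem_closedBall_self hρ)
    (edist_ne_top _ _)
  exact ⟨v, mem_closedBall_zero_iff.1 hv, hfix⟩

lemma exists_riccati_fixedPoint {R : Type*} [NormedRing R] [CompleteSpace R] {x t : R →+ R}
    (hx : ∀ w, ‖x w‖ ≤ ‖w‖) (ht : ∀ w, ‖t w‖ ≤ ‖w‖) {a b c g : R} {ρ : ℝ} (hb : ‖b‖ ≤ ρ / 2)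
    (h : ‖a‖ + ‖c‖ + 2 * ρ * ‖g‖ ≤ 1 / 2) :
    ∃ w, ‖w‖ ≤ ρ ∧ b + a * t w - x w * c - x w * g * t w = w := by
  refine exists_fixedPoint_of_half_lipschitz (by simpa using hb) fun v w hv hw => ?_
  have difference :
      b + a * t v - x v * c - x v * g * t v - (b + a * t w - x w * c - x w * g * t w) =
        a * t (v - w) - x (v - w) * c - x (v - w) * g * t v - x w * g * t (v - w) := by
    simp only [map_sub]
    noncomm_ring
  rw [difference]
  calc _ ≤ ‖a‖ * ‖t (v - w)‖ + ‖x (v - w)‖ * ‖c‖ + ‖x (v - w)‖ * ‖g‖ * ‖t v‖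
        + ‖x w‖ * ‖g‖ * ‖t (v - w)‖ := by
        refine norm_sub_le_of_le (norm_sub_le_of_le (norm_sub_le_of_le ?_ ?_) ?_) ?_
        exacts [norm_mul_le _ _, norm_mul_le _ _, norm_mul₃_le, norm_mul₃_le]
    _ ≤ ‖a‖ * ‖v - w‖ + ‖v - w‖ * ‖c‖ + ‖v - w‖ * ‖g‖ * ρ + ρ * ‖g‖ * ‖v - w‖ := by
        have hρ : 0 ≤ ρ := (norm_nonneg _).trans hw
        gcongr
        exacts [ht _, hx _, hx _, (ht v).trans hv, (hx w).trans hw, ht _]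
    _ = (‖a‖ + ‖c‖ + 2 * ρ * ‖g‖) * ‖v - w‖ := by ring
    _ ≤ 1 / 2 * ‖v - w‖ := by gcongr

/-- The inverse of the Sylvester operator `X ↦ X + D X D⁻¹`, where `D` is the diagonal matrix
with positive entries `s`. -/
def sylvesterInv {ι : Type*} (s : ι → ℝ) : Matrix ι ι ℝ →+ Matrix ι ι ℝ where
  toFun W := of fun i j => W i j / (1 + s i * (s j)⁻¹)
  map_zero' := by ext; simp
  map_add' V W := by ext; simp [add_div]

variable {ι : Type*} [Fintype ι] [DecidableEq ι]

lemma sylvesterInv_add_conj {s : ι → ℝ} (hs : ∀ i, 0 < s i) (W : Matrix ι ι ℝ) :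
    sylvesterInv s W + diagonal s * sylvesterInv s W * diagonal s⁻¹ = W := by
  ext i j
  have hi := hs i
  have hj := hs j
  simp only [sylvesterInv, AddMonoidHom.coe_mk, ZeroHom.coe_mk, Matrix.add_apply, of_apply,
    mul_diagonal, diagonal_mul, Pi.inv_apply]
  field_simp

lemma sylvesterInv_corner (p : ι → Prop) [DecidablePred p] (s : ι → ℝ) (W : Matrix ι ι ℝ) :
    sylvesterInv s ((1 - coordProj p) * W * coordProj p) =
      (1 - coordProj p) * sylvesterInv s W * coordProj p := by
  rw [coordProj, ← diagonal_one, diagonal_sub]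
  ext i j
  simp only [sylvesterInv, AddMonoidHom.coe_mk, ZeroHom.coe_mk, of_apply, mul_diagonal,
    diagonal_mul]
  ring

lemma norm_sylvesterInv_le {s : ι → ℝ} (hs : ∀ i, 0 < s i) (W : Matrix ι ι ℝ) :
    ‖sylvesterInv s W‖ ≤ ‖W‖ := by
  simpa only [sylvesterInv_add_conj hs] using
    frobenius_norm_le_norm_add_diagonal_conj hs hs (sylvesterInv s W)

lemma norm_sub_sylvesterInv_le {s : ι → ℝ} (hs : ∀ i, 0 < s i) (W : Matrix ι ι ℝ) :
    ‖W - sylvesterInv s W‖ ≤ ‖W‖ := by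
  simpa only [sylvesterInv_add_conj hs, sub_eq_of_eq_add' (sylvesterInv_add_conj hs W).symm] using
    frobenius_norm_diagonal_conj_le_norm_add hs hs (sylvesterInv s W)

lemma exists_riccati_sylvester (p : ι → Prop) [DecidablePred p] {s : ι → ℝ} (hs : ∀ i, 0 < s i)
    {a b c g : Matrix ι ι ℝ} {ρ : ℝ} (ha : (1 - coordProj p) * a = a)
    (hb : (1 - coordProj p) * b = b) (hb' : b * coordProj p = b) (hc : c * coordProj p = c)
    (hbρ : ‖b‖ ≤ ρ / 2) (h : ‖a‖ + ‖c‖ + 2 * ρ * ‖g‖ ≤ 1 / 2) :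
    ∃ X T : Matrix ι ι ℝ, T = diagonal s * X * diagonal s⁻¹ ∧ coordProj p * X = 0 ∧
      X * coordProj p = X ∧ ‖X‖ ≤ ρ ∧ ‖T‖ ≤ ρ ∧ X + T = b + a * T - X * c - X * g * T := by
  set e := coordProj p
  have he : e * e = e := coordProj_mul_self p
  let corner : Matrix ι ι ℝ →+ Matrix ι ι ℝ :=
    (AddMonoidHom.mulRight e).comp (AddMonoidHom.mulLeft (1 - e))
  let x : Matrix ι ι ℝ →+ Matrix ι ι ℝ := (sylvesterInv s).comp corner
  let t : Matrix ι ι ℝ →+ Matrix ι ι ℝ := corner - x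
  have hx (w) : ‖x w‖ ≤ ‖w‖ := (norm_sylvesterInv_le hs _).trans (norm_corner_le p w)
  have ht (w) : ‖t w‖ ≤ ‖w‖ := (norm_sub_sylvesterInv_le hs _).trans (norm_corner_le p w)
  have x_eq (w) : x w = (1 - e) * sylvesterInv s w * e := sylvesterInv_corner p s w
  have qx (w) : (1 - e) * x w = x w := by
    rw [x_eq, ← mul_assoc, ← mul_assoc, (isStarProjection_coordProj p).one_sub.isIdempotentElem.eq]
  have xe (w) : x w * e = x w := by rw [x_eq, mul_assoc, he]
  have te (w) : t w * e = t w := by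
    change ((1 - e) * w * e - x w) * e = (1 - e) * w * e - x w
    rw [sub_mul, xe, mul_assoc _ e, he]
  obtain ⟨w, hw, hfix⟩ := exists_riccati_fixedPoint hx ht hbρ h
  have corner_w : corner w = w := by
    change (1 - e) * w * e = w
    rw [← hfix]
    simp only [mul_add, mul_sub, add_mul, sub_mul, ← mul_assoc, ha, hb, qx]
    simp only [mul_assoc, hb', hc, te]
  refine ⟨x w, t w, sub_eq_of_eq_add' (sylvesterInv_add_conj hs (corner w)).symm, ?_, xe w,
    (hx w).trans hw, (ht w).trans hw, ?_⟩
  · rw [← qx, ← mul_assoc, (isStarProjection_coordProj p).mul_one_sub_self, zero_mul]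
  · rw [hfix]
    exact (add_sub_cancel (x w) (corner w)).trans corner_w

end Riccati

section Shear

lemma shear_blocks {R : Type*} [Ring R] {e E X L T : R} (he : e * e = e) (eX : e * X = 0)
    (Xe : X * e = X) (eL : e * L = L) (Le : L * e = 0) (eT : e * T = 0) (Te : T * e = T) :
    let M := (1 - X) * (2 * e - 1 + E) * (1 + L) * (1 + T)
    (1 - e) * M * e = (1 - e) * E * e + ((1 - e) * E + (1 - e) * E * e * L) * T - X * (E * e)
        - X * (E * (1 + L) + L) * T - (X + T) ∧
      e * M * e - e = L * T + e * E * e + e * E * (1 + L) * T ∧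
      (1 - e) * M * (1 - e) + (1 - e) = (1 - e) * E * (1 - e) + (1 - e) * E * e * L - X * L
        - X * (E * (1 - e)) - X * E * L := by
  have h₁ (Y : R) : e * (X * Y) = 0 := by rw [← mul_assoc, eX, zero_mul]
  have h₂ (Y : R) : e * (L * Y) = L * Y := by rw [← mul_assoc, eL]
  have h₃ : X * T = 0 := by rw [← Xe, mul_assoc, eT, mul_zero]
  refine ⟨?_, ?_, ?_⟩ <;>
  · simp only [two_mul, mul_add, add_mul, mul_sub, sub_mul, mul_assoc, one_mul, mul_one, mul_neg,
      neg_mul, he, eX, Xe, eL, Le, eT, Te, h₁, h₂, h₃, mul_zero, zero_mul, sub_zero, zero_sub,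
      add_zero]
    abel

lemma mul_mul_one_add_eq_one_add_mul {R : Type*} [Ring R] {D T X : R} (XX : X * X = 0)
    (DX : D * X = T * D) (Y : R) :
    Y * D * (1 + X) = (1 + X) * ((1 - X) * Y * (1 + T) * D) := by
  have h : (1 + X) * (1 - X) = 1 := by
    simp only [add_mul, mul_sub, one_mul, mul_one, XX]
    abel
  simp only [← mul_assoc, h, one_mul]
  rw [mul_assoc, mul_add, mul_one, DX, mul_assoc Y, add_mul, one_mul]

variable {ι : Type*} [Fintype ι] [DecidableEq ι] (p : ι → Prop) [DecidablePred p]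

/-- The orthogonal projection onto the subspace spanned by the columns of `V` whose index
satisfies `p`. -/
def frameProj (V : orthogonalGroup ι ℝ) : Matrix ι ι ℝ :=
  V * coordProj p * star (V : Matrix ι ι ℝ)

/-- The orthogonal reflection that fixes the coordinate subspace of `p` and is `-1` on its
orthogonal complement. -/
def coordRefl : orthogonalGroup ι ℝ :=
  ⟨2 * coordProj p - 1, (isStarProjection_coordProj p).two_mul_sub_one_mem_unitary⟩

open scoped Matrix.Norms.Frobenius

/-- The orthogonal matrices close to the reflection `coordRefl p` and moving the coordinate
subspace of `p` by at most `r / 16`. Only the second condition tightens with `r`. -/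
def nearRefl (r : ℝ) : Set (orthogonalGroup ι ℝ) :=
  {U | ‖(U : Matrix ι ι ℝ) - coordRefl p‖ ≤ 1 / 16 ∧ ‖frameProj p U - coordProj p‖ ≤ r / 16}

/-- In the block decomposition given by `p`, the matrix `C` is upper triangular and, up to a
positive diagonal factor on the right, its diagonal blocks are close to `1` and `-1`. -/
def IsSplit (C : Matrix ι ι ℝ) : Prop :=
  ∃ (M : Matrix ι ι ℝ) (s : ι → ℝ), (∀ i, 0 < s i) ∧ C = M * diagonal s ∧
    (1 - coordProj p) * M * coordProj p = 0 ∧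
    ‖coordProj p * M * coordProj p - coordProj p‖ ≤ 1 / 4 ∧
    ‖(1 - coordProj p) * M * (1 - coordProj p) + (1 - coordProj p)‖ ≤ 1 / 4

lemma norm_corner_sub_coordRefl_le (U : orthogonalGroup ι ℝ) :
    ‖(1 - coordProj p) * ((U : Matrix ι ι ℝ) - coordRefl p) * coordProj p‖ ≤
      ‖frameProj p U - coordProj p‖ := by
  have he := coordProj_mul_self p
  have factor : (1 - coordProj p) * ((U : Matrix ι ι ℝ) - coordRefl p) * coordProj p =
      (1 - coordProj p) * (frameProj p U - coordProj p) * U := by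
    simp only [frameProj, coordRefl, two_mul, mul_sub, sub_mul, mul_add, add_mul, mul_assoc,
      Unitary.coe_star_mul_self, mul_one, one_mul]
    simp only [← mul_assoc, he]
    abel
  rw [factor, frobenius_norm_mul_orthogonal]
  exact frobenius_norm_proj_mul_le (isStarProjection_coordProj p).one_sub _

lemma norm_shear_diagonal_blocks_le {E X L T : Matrix ι ι ℝ} {r : ℝ}
    (hE : ‖E‖ ≤ 1 / 16) (hb : ‖(1 - coordProj p) * E * coordProj p‖ ≤ r / 16)
    (hX : ‖X‖ ≤ r / 8) (hT : ‖T‖ ≤ r / 8) (hr : r * (1 + ‖L‖) ≤ 1 / 4) :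
    ‖L * T + coordProj p * E * coordProj p + coordProj p * E * (1 + L) * T‖ ≤ 1 / 4 ∧
      ‖(1 - coordProj p) * E * (1 - coordProj p) + (1 - coordProj p) * E * coordProj p * L
        - X * L - X * (E * (1 - coordProj p)) - X * E * L‖ ≤ 1 / 4 := by
  have hP := isStarProjection_coordProj p
  have hL := norm_nonneg L
  have hr0 : 0 ≤ r := by linarith [norm_nonneg X]
  have hrL : r * ‖L‖ ≤ 1 / 4 := by nlinarith
  have hr4 : r ≤ 1 / 4 := by nlinarith
  have heE : ‖coordProj p * E‖ ≤ 1 / 16 := (frobenius_norm_proj_mul_le hP _).trans hE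
  have hqE : ‖(1 - coordProj p) * E‖ ≤ 1 / 16 :=
    (frobenius_norm_proj_mul_le hP.one_sub _).trans hE
  have hEq : ‖E * (1 - coordProj p)‖ ≤ 1 / 16 :=
    (frobenius_norm_mul_proj_le hP.one_sub _).trans hE
  constructor
  · calc _ ≤ ‖L‖ * (r / 8) + 1 / 16 + (1 / 16 * (r / 8) + 1 / 16 * ‖L‖ * (r / 8)) := by
          rw [mul_add, mul_one, add_mul]
          refine norm_add_le_of_le (norm_add_le_of_le ?_ ?_) (norm_add_le_of_le ?_ ?_)
          · exact norm_mul_le_of_le le_rfl hT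
          · exact (frobenius_norm_mul_proj_le hP _).trans heE
          · exact norm_mul_le_of_le heE hT
          · exact norm_mul_le_of_le (norm_mul_le_of_le heE le_rfl) hT
      _ ≤ 1 / 4 := by nlinarith [hrL, hr4]
  · calc _ ≤ 1 / 16 + r / 16 * ‖L‖ + r / 8 * ‖L‖ + r / 8 * (1 / 16) + r / 8 * (1 / 16) * ‖L‖ := by
          refine norm_sub_le_of_le (norm_sub_le_of_le (norm_sub_le_of_le
            (norm_add_le_of_le ?_ ?_) ?_) ?_) ?_
          · exact (frobenius_norm_mul_proj_le hP.one_sub _).trans hqE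
          · exact norm_mul_le_of_le hb le_rfl
          · exact norm_mul_le_of_le hX le_rfl
          · exact norm_mul_le_of_le hX hEq
          · exact norm_mul_le_of_le (norm_mul_le_of_le hX hE) le_rfl
      _ ≤ 1 / 4 := by nlinarith [hrL, hr4]

variable {p}

lemma exists_shear_corner_eq_zero {E L : Matrix ι ι ℝ} (eL : coordProj p * L = L)
    (Le : L * coordProj p = 0) {s : ι → ℝ} (hs : ∀ i, 0 < s i) {r : ℝ} (hE : ‖E‖ ≤ 1 / 16)
    (hb : ‖(1 - coordProj p) * E * coordProj p‖ ≤ r / 16) (hr : r * (1 + ‖L‖) ≤ 1 / 4) :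
    ∃ X T : Matrix ι ι ℝ, T * diagonal s = diagonal s * X ∧ coordProj p * X = 0 ∧
      X * coordProj p = X ∧ coordProj p * T = 0 ∧ T * coordProj p = T ∧ ‖X‖ ≤ r / 8 ∧
      ‖T‖ ≤ r / 8 ∧ (1 - coordProj p) *
        ((1 - X) * (2 * coordProj p - 1 + E) * (1 + L) * (1 + T)) * coordProj p = 0 := by
  have hP := isStarProjection_coordProj p
  have he := coordProj_mul_self p
  set e := coordProj p with e_def
  have hr0 : 0 ≤ r := by linarith [norm_nonneg ((1 - e) * E * e)]
  have ha : ‖(1 - e) * E + (1 - e) * E * e * L‖ ≤ 1 / 16 + r / 16 * ‖L‖ :=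
    norm_add_le_of_le ((frobenius_norm_proj_mul_le hP.one_sub _).trans hE)
      (norm_mul_le_of_le hb le_rfl)
  have hc : ‖E * e‖ ≤ 1 / 16 := (frobenius_norm_mul_proj_le hP _).trans hE
  have hg : ‖E * (1 + L) + L‖ ≤ 1 / 16 + 1 / 16 * ‖L‖ + ‖L‖ := by
    rw [mul_add, mul_one]
    exact norm_add_le_of_le (norm_add_le_of_le hE (norm_mul_le_of_le hE le_rfl)) le_rfl
  obtain ⟨X, T, T_eq, eX, Xe, hX, hT, riccati⟩ :=
    exists_riccati_sylvester p hs (a := (1 - e) * E + (1 - e) * E * e * L)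
      (b := (1 - e) * E * e) (c := E * e) (g := E * (1 + L) + L) (ρ := r / 8)
      (by simp only [mul_add, ← mul_assoc, ← e_def, hP.one_sub.isIdempotentElem.eq])
      (by simp only [← mul_assoc, ← e_def, hP.one_sub.isIdempotentElem.eq])
      (by rw [mul_assoc, he]) (by rw [mul_assoc, he]) (hb.trans_eq (by ring))
      (by nlinarith [norm_nonneg L])
  have eT : e * T = 0 := by
    rw [T_eq, ← mul_assoc, ← mul_assoc, coordProj_mul_diagonal, mul_assoc (diagonal s), eX,
      mul_zero, zero_mul]
  have Te : T * e = T := by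
    rw [T_eq, mul_assoc, ← coordProj_mul_diagonal, ← mul_assoc, mul_assoc (diagonal s), Xe]
  refine ⟨X, T, ?_, eX, Xe, eT, Te, hX, hT, ?_⟩
  · rw [T_eq, mul_assoc, diagonal_inv_mul_diagonal hs, mul_one]
  · rw [(shear_blocks he eX Xe eL Le eT Te).1, riccati, sub_self]

/-- The reflection is what makes the linear part of the equation for the shear `1 + X` the
operator `X ↦ X + D X D⁻¹`, whose inverse is bounded independently of `D = diagonal s`. -/
lemma exists_shear_isSplit {L : Matrix ι ι ℝ} (eL : coordProj p * L = L)
    (Le : L * coordProj p = 0) {s : ι → ℝ} (hs : ∀ i, 0 < s i) {r : ℝ}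
    (hr : r * (1 + ‖L‖) ≤ 1 / 4) {U : orthogonalGroup ι ℝ} (hU : U ∈ nearRefl p r) :
    ∃ X C : Matrix ι ι ℝ, X * coordProj p = X ∧ ‖X‖ ≤ r / 8 ∧ IsSplit p C ∧
      U * (1 + L) * diagonal s * (1 + X) = (1 + X) * C := by
  have hE : ‖(U : Matrix ι ι ℝ) - coordRefl p‖ ≤ 1 / 16 := hU.1
  have hb := (norm_corner_sub_coordRefl_le p U).trans hU.2
  set E := (U : Matrix ι ι ℝ) - coordRefl p
  have U_eq : (U : Matrix ι ι ℝ) = 2 * coordProj p - 1 + E := (add_sub_cancel _ _).symm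
  obtain ⟨X, T, TD, eX, Xe, eT, Te, hX, hT, corner⟩ :=
    exists_shear_corner_eq_zero eL Le hs hE hb hr
  obtain ⟨-, upperLeft, lowerRight⟩ :=
    shear_blocks (E := E) (coordProj_mul_self p) eX Xe eL Le eT Te
  obtain ⟨upperLeft_le, lowerRight_le⟩ := norm_shear_diagonal_blocks_le p hE hb hX hT hr
  rw [← upperLeft] at upperLeft_le
  rw [← lowerRight] at lowerRight_le
  have XX : X * X = 0 := by
    nth_rw 1 [← Xe]
    rw [mul_assoc, eX, mul_zero]
  refine ⟨X, _, Xe, hX, ⟨_, s, hs, rfl, corner, upperLeft_le, lowerRight_le⟩, ?_⟩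
  rw [U_eq, mul_mul_one_add_eq_one_add_mul XX TD.symm]
  simp only [mul_assoc]

end Shear

section BlockQR

lemma exists_orthogonal_diagonalization {m : Type*} [Fintype m] [DecidableEq m]
    {H : Matrix m m ℝ} (hH : H.PosDef) :
    ∃ (K : orthogonalGroup m ℝ) (s : m → ℝ), (∀ i, 0 < s i) ∧
      H = K * (diagonal s * diagonal s) * star (K : Matrix m m ℝ) := by
  refine ⟨hH.isHermitian.eigenvectorUnitary, fun i => √(hH.isHermitian.eigenvalues i),
    fun i => Real.sqrt_pos.2 (hH.eigenvalues_pos i), ?_⟩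
  simp only [diagonal_mul_diagonal, Real.mul_self_sqrt (hH.eigenvalues_pos _).le]
  exact hH.isHermitian.spectral_theorem.trans (Unitary.conjStarAlgAut_apply _ _)

lemma exists_fromBlocks_ldl {m n : Type*} [Fintype m] [DecidableEq m] [Fintype n] [DecidableEq n]
    {H : Matrix (m ⊕ n) (m ⊕ n) ℝ} (hH : H.PosDef) :
    ∃ (A : Matrix m m ℝ) (S : Matrix n n ℝ) (N : Matrix m n ℝ), A.PosDef ∧ S.PosDef ∧
      H = star (fromBlocks 1 N 0 1) * fromBlocks A 0 0 S * fromBlocks 1 N 0 1 := by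
  have hA : H.toBlocks₁₁.PosDef := hH.submatrix Sum.inl_injective
  let : Invertible H.toBlocks₁₁ := hA.isUnit.invertible
  have ldl := fromBlocks_eq_of_invertible₁₁ H.toBlocks₁₁ H.toBlocks₁₂ H.toBlocks₂₁ H.toBlocks₂₂
  set S := H.toBlocks₂₂ - H.toBlocks₂₁ * ⅟H.toBlocks₁₁ * H.toBlocks₁₂
  set N := ⅟H.toBlocks₁₁ * H.toBlocks₁₂ with N_def
  have hN : fromBlocks 1 0 (H.toBlocks₂₁ * ⅟H.toBlocks₁₁) 1 =
      star (fromBlocks 1 N 0 1 : Matrix (m ⊕ n) (m ⊕ n) ℝ) := by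
    have hC : H.toBlocks₁₂ᴴ = H.toBlocks₂₁ := congrArg toBlocks₂₁ hH.isHermitian.eq
    rw [star_eq_conjTranspose, fromBlocks_conjTranspose, N_def, conjTranspose_mul, hC,
      invOf_eq_nonsing_inv, hA.isHermitian.inv.eq, conjTranspose_one, conjTranspose_one,
      conjTranspose_zero]
  rw [fromBlocks_toBlocks, hN] at ldl
  refine ⟨_, _, N, hA, ?_, ldl⟩
  have hunit : IsUnit (fromBlocks 1 N 0 1 : Matrix (m ⊕ n) (m ⊕ n) ℝ) := by
    simp [isUnit_iff_isUnit_det]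
  exact ((IsUnit.posDef_star_left_conjugate_iff hunit).1 (ldl ▸ hH)).submatrix Sum.inr_injective

variable {ι : Type*} [Fintype ι] [DecidableEq ι] (p : ι → Prop) [DecidablePred p]

lemma reindexAlgEquiv_sumCompl_fromBlocks_one :
    reindexAlgEquiv ℝ ℝ (Equiv.sumCompl p) (fromBlocks 1 0 0 0) = coordProj p := by
  rw [← diagonal_one, ← diagonal_zero, fromBlocks_diagonal, coe_reindexAlgEquiv, reindex_apply,
    submatrix_diagonal_equiv, coordProj]
  congr 1
  ext i
  by_cases hi : p i <;> simp [hi]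

lemma exists_block_ldl {H : Matrix ι ι ℝ} (hH : H.PosDef) :
    ∃ (K : orthogonalGroup ι ℝ) (N : Matrix ι ι ℝ) (s : ι → ℝ), (∀ i, 0 < s i) ∧
      Commute (coordProj p) K ∧ coordProj p * N = N ∧ N * coordProj p = 0 ∧
      H = star (1 + N) * (K * (diagonal s * diagonal s) * star (K : Matrix ι ι ℝ)) * (1 + N) := by
  let σ := Equiv.sumCompl p
  let φ := reindexAlgEquiv ℝ ℝ σ
  have φ_star (Y) : φ (star Y) = star (φ Y) := rfl
  obtain ⟨A, S, N, hA, hS, hN⟩ := exists_fromBlocks_ldl (hH.submatrix σ.injective)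
  obtain ⟨K₁, s₁, hs₁, rfl⟩ := exists_orthogonal_diagonalization hA
  obtain ⟨K₂, s₂, hs₂, rfl⟩ := exists_orthogonal_diagonalization hS
  set K := fromBlocks K₁.1 0 0 K₂.1 with K_def
  have star_K : star K = fromBlocks (star (K₁ : Matrix _ _ ℝ)) 0 0 (star (K₂ : Matrix _ _ ℝ)) := by
    simp only [K_def, star_eq_conjTranspose, fromBlocks_conjTranspose, conjTranspose_zero]
  have hK : star (φ K) * φ K = 1 := by
    rw [← φ_star, ← map_mul, star_K, fromBlocks_multiply]
    simp only [Unitary.coe_star_mul_self, Matrix.mul_zero, Matrix.zero_mul, add_zero, zero_add,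
      fromBlocks_one, map_one]
  have hs : diagonal (Sum.elim s₁ s₂ ∘ σ.symm) = φ (diagonal (Sum.elim s₁ s₂)) :=
    (submatrix_diagonal_equiv _ _).symm
  refine ⟨⟨φ K, (mem_orthogonalGroup_iff' ι ℝ).2 hK⟩,
    φ (fromBlocks 0 N 0 0), Sum.elim s₁ s₂ ∘ σ.symm, ?_, ?_, ?_, ?_, ?_⟩
  · intro i
    rcases h : σ.symm i with j | j <;> simp [h, hs₁, hs₂]
  · rw [Commute, SemiconjBy, ← reindexAlgEquiv_sumCompl_fromBlocks_one, ← map_mul, ← map_mul,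
      fromBlocks_multiply, fromBlocks_multiply]
    simp [φ, σ]
  · rw [← reindexAlgEquiv_sumCompl_fromBlocks_one, ← map_mul, fromBlocks_multiply]
    simp [φ, σ]
  · rw [← reindexAlgEquiv_sumCompl_fromBlocks_one, ← map_mul, fromBlocks_multiply]
    simp
  · have hN' : 1 + φ (fromBlocks 0 N 0 0) = φ (fromBlocks 1 N 0 1) := by
      rw [← map_one φ, ← map_add, ← fromBlocks_one, fromBlocks_add]
      simp
    have hφ : φ (H.submatrix σ σ) = H := by simp [φ]
    rw [hs, hN', ← φ_star, ← φ_star, ← map_mul, ← map_mul, ← map_mul, ← map_mul, ← map_mul, ← hφ,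
      hN, ← fromBlocks_diagonal, star_K, fromBlocks_multiply, fromBlocks_multiply,
      fromBlocks_multiply]
    simp only [Matrix.mul_zero, Matrix.zero_mul, add_zero, zero_add]

variable {p}

lemma exists_eq_orthogonal_mul {M R : Matrix ι ι ℝ} (hR : IsUnit R)
    (h : star M * M = star R * R) : ∃ W : orthogonalGroup ι ℝ, M = W * R := by
  rw [isUnit_iff_isUnit_det] at hR
  have hW : star (M * R⁻¹) * (M * R⁻¹) = 1 :=
    calc star (M * R⁻¹) * (M * R⁻¹) = star R⁻¹ * (star M * M) * R⁻¹ := by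
          simp only [star_mul, mul_assoc]
      _ = star (R * R⁻¹) * (R * R⁻¹) := by simp only [h, star_mul, mul_assoc]
      _ = 1 := by rw [mul_nonsing_inv _ hR, star_one, mul_one]
  exact ⟨⟨M * R⁻¹, (mem_orthogonalGroup_iff' ι ℝ).2 hW⟩, (nonsing_inv_mul_cancel_right R M hR).symm⟩

variable (p) in
lemma exists_block_qr {M : Matrix ι ι ℝ} (hM : IsUnit M) :
    ∃ (K W : orthogonalGroup ι ℝ) (L : Matrix ι ι ℝ) (s : ι → ℝ), (∀ i, 0 < s i) ∧
      Commute (coordProj p) K ∧ coordProj p * L = L ∧ L * coordProj p = 0 ∧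
      M * K = W * (1 + L) * diagonal s := by
  have hpos : (star M * M).PosDef := by
    simpa using (IsUnit.posDef_star_left_conjugate_iff hM).2 PosDef.one
  obtain ⟨K, N, s, hs, hK, eN, Ne, hMN⟩ := exists_block_ldl p hpos
  have hKK := Unitary.coe_star_mul_self K
  have hdiag := diagonal_inv_mul_diagonal hs
  have hsK : Commute (coordProj p) (star (K : Matrix ι ι ℝ)) := by
    have := hK.star_star
    rwa [(isStarProjection_coordProj p).isSelfAdjoint.star_eq] at this
  set L := diagonal s * (star (K : Matrix ι ι ℝ) * N * K) * diagonal s⁻¹ with hL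
  have eL : coordProj p * L = L := by
    simp only [hL, ← mul_assoc, coordProj_mul_diagonal]
    rw [mul_assoc (diagonal s), hsK.eq, ← mul_assoc, mul_assoc _ _ N, eN]
  have Le : L * coordProj p = 0 := by
    rw [hL, mul_assoc, ← coordProj_mul_diagonal]
    simp only [mul_assoc]
    rw [← mul_assoc (K : Matrix ι ι ℝ), ← hK.eq, mul_assoc (coordProj p), ← mul_assoc N, Ne]
    simp
  have hR : diagonal s * star (K : Matrix ι ι ℝ) * (1 + N) * K = (1 + L) * diagonal s := by
    simp only [hL, mul_add, add_mul, mul_assoc, hdiag, mul_one, one_mul, hKK]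
  have hunit : IsUnit ((1 + L) * diagonal s) := by
    have hLL : L * L = 0 := by
      nth_rw 2 [← eL]
      rw [← mul_assoc, Le, zero_mul]
    refine (IsNilpotent.isUnit_one_add ⟨2, by rw [sq, hLL]⟩).mul ?_
    exact .of_mul_eq_one _ (diagonal_mul_diagonal_inv hs)
  obtain ⟨W, hW⟩ := exists_eq_orthogonal_mul (M := M * (K : Matrix ι ι ℝ)) hunit <| by
    rw [← hR]
    calc star (M * K.1) * (M * K) = star (K : Matrix ι ι ℝ) * (star M * M) * K := by
          simp only [star_mul, mul_assoc]
      _ = _ := by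
          rw [hMN]
          simp only [star_mul, star_star, star_eq_conjTranspose (diagonal s),
            diagonal_conjTranspose, star_trivial, mul_assoc]
  exact ⟨K, W, L, s, hs, hK, eL, Le, by rw [hW, mul_assoc]⟩

end BlockQR

section SplitInvariant

variable {ι : Type*} [Fintype ι] [DecidableEq ι] {p : ι → Prop} [DecidablePred p]

lemma corner_eq_zero_iff_blockTriangular {R : Matrix ι ι ℝ} :
    (1 - coordProj p) * R * coordProj p = 0 ↔ R.BlockTriangular (¬ p ·) := by
  have entry (i j) :
      ((1 - coordProj p) * R * coordProj p) i j = if ¬ p i ∧ p j then R i j else 0 := by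
    rw [coordProj, ← diagonal_one, diagonal_sub, mul_diagonal, diagonal_mul]
    by_cases hi : p i <;> by_cases hj : p j <;> simp [hi, hj]
  constructor
  · intro h i j hij
    have hij' : ¬ p i ∧ p j := by simpa using (lt_iff_le_not_ge.1 hij).2
    simpa [entry, hij'] using congrFun₂ h i j
  · intro h
    ext i j
    rw [entry, Matrix.zero_apply]
    split_ifs with hij
    · exact h (by simp [lt_iff_le_not_ge, hij])
    · rfl

lemma corner_mul_eq_zero {R S : Matrix ι ι ℝ} (hR : (1 - coordProj p) * R * coordProj p = 0)
    (hS : (1 - coordProj p) * S * coordProj p = 0) :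
    (1 - coordProj p) * (R * S) * coordProj p = 0 := by
  rw [corner_eq_zero_iff_blockTriangular] at *
  exact hR.mul hS

lemma corner_inv_eq_zero {R : Matrix ι ι ℝ} (hu : IsUnit R)
    (hR : (1 - coordProj p) * R * coordProj p = 0) :
    (1 - coordProj p) * R⁻¹ * coordProj p = 0 := by
  let := hu.invertible
  rw [corner_eq_zero_iff_blockTriangular] at *
  exact blockTriangular_inv_of_blockTriangular hR

lemma corner_eq_zero_of_commute {R : Matrix ι ι ℝ} (hR : Commute (coordProj p) R) :
    (1 - coordProj p) * R * coordProj p = 0 := by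
  rw [mul_assoc, ← hR.eq, ← mul_assoc, (isStarProjection_coordProj p).one_sub_mul_self, zero_mul]

lemma eq_coordProj_mul_of_corner_eq_zero {R : Matrix ι ι ℝ}
    (hR : (1 - coordProj p) * R * coordProj p = 0) :
    R * coordProj p = coordProj p * R * coordProj p := by
  rwa [sub_mul, sub_mul, one_mul, sub_eq_zero] at hR

open scoped Matrix.Norms.Frobenius

lemma eq_zero_of_mul_eq_mul_diagonal_conj {Y N N' : Matrix ι ι ℝ} {s t : ι → ℝ}
    (hs : ∀ i, 0 < s i) (ht : ∀ i, 0 < t i) (eY : coordProj p * Y = 0)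
    (Ye : Y * coordProj p = Y) (hN : ‖N - coordProj p‖ ≤ 1 / 4)
    (hN' : ‖N' + (1 - coordProj p)‖ ≤ 1 / 4)
    (h : Y * N = N' * (diagonal t * Y * diagonal s⁻¹)) : Y = 0 := by
  have he_t := coordProj_mul_diagonal p t
  set e := coordProj p
  set T := diagonal t * Y * diagonal s⁻¹ with hT
  have eT : e * T = 0 := by
    rw [hT, ← mul_assoc, ← mul_assoc, he_t, mul_assoc _ e, eY, mul_zero, zero_mul]
  have sum_eq : Y + T = -(Y * (N - e)) + (N' + (1 - e)) * T := by
    rw [mul_sub, add_mul, h, sub_mul, one_mul, eT, Ye]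
    abel
  have Y_le := frobenius_norm_le_norm_add_diagonal_conj hs ht Y
  have contraction : ‖Y + T‖ ≤ ‖Y + T‖ * (1 / 4) + 1 / 4 * ‖Y + T‖ := by
    conv_lhs => rw [sum_eq]
    refine norm_add_le_of_le ?_ ?_
    · rw [norm_neg]
      exact norm_mul_le_of_le Y_le hN
    · exact norm_mul_le_of_le hN' (frobenius_norm_diagonal_conj_le_norm_add hs ht Y)
  exact norm_le_zero_iff.1 (Y_le.trans (by linarith))

lemma corner_eq_zero_of_intertwines {C C' Z : Matrix ι ι ℝ} (hC : IsSplit p C)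
    (hC' : IsSplit p C') (hZ : Z * C = C' * Z) : (1 - coordProj p) * Z * coordProj p = 0 := by
  obtain ⟨M, s, hs, rfl, hM, hM₁, -⟩ := hC
  obtain ⟨M', t, ht, rfl, hM', -, hM'₂⟩ := hC'
  have he := coordProj_mul_self p
  have hMe := eq_coordProj_mul_of_corner_eq_zero hM
  have hqM' : (1 - coordProj p) * M' = (1 - coordProj p) * M' * (1 - coordProj p) := by
    rw [mul_sub, hM', mul_one, sub_zero]
  have he_s := coordProj_mul_diagonal p s
  have hq_t : (1 - coordProj p) * diagonal t = diagonal t * (1 - coordProj p) := by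
    rw [sub_mul, mul_sub, coordProj_mul_diagonal, one_mul, mul_one]
  set e := coordProj p
  have Ye : (1 - e) * Z * e * e = (1 - e) * Z * e := by rw [mul_assoc, he]
  have eY : e * ((1 - e) * Z * e) = 0 := by
    rw [← mul_assoc, ← mul_assoc, mul_sub, mul_one, he, sub_self, zero_mul, zero_mul]
  refine eq_zero_of_mul_eq_mul_diagonal_conj hs ht eY Ye hM₁ hM'₂ ?_
  calc (1 - e) * Z * e * (e * M * e)
    _ = (1 - e) * Z * (M * e) * (diagonal s * diagonal s⁻¹) := by
      rw [hMe, diagonal_mul_diagonal_inv hs, mul_one, ← mul_assoc, ← mul_assoc, Ye]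
      simp only [mul_assoc]
    _ = (1 - e) * (Z * (M * diagonal s)) * e * diagonal s⁻¹ := by
      simp only [mul_assoc]
      rw [← mul_assoc e, he_s, mul_assoc]
    _ = (1 - e) * M' * (1 - e) * diagonal t * Z * e * diagonal s⁻¹ := by
      rw [hZ, ← hqM']
      simp only [mul_assoc]
    _ = (1 - e) * M' * (1 - e) * (diagonal t * ((1 - e) * Z * e) * diagonal s⁻¹) := by
      have move : diagonal t * ((1 - e) * Z * e) = (1 - e) * (diagonal t * Z * e) := by
        simp only [← mul_assoc, hq_t]
      rw [← hqM', move]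
      simp only [← hqM', ← mul_assoc]

/-- The first block of columns of `V` spans an invariant subspace of `B` and, in a suitable basis
extending a basis of this subspace, `B` is split in the sense of `IsSplit`. -/
def IsSplitInvariant (p : ι → Prop) [DecidablePred p] (B : Matrix ι ι ℝ)
    (V : orthogonalGroup ι ℝ) : Prop :=
  ∃ R C : Matrix ι ι ℝ, IsUnit R ∧ (1 - coordProj p) * R * coordProj p = 0 ∧ IsSplit p C ∧
    B * (V * R) = V * R * C

variable (p) in
lemma one_sub_frameProj (V : orthogonalGroup ι ℝ) :
    1 - frameProj p V = V * (1 - coordProj p) * star (V : Matrix ι ι ℝ) := by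
  rw [mul_sub, sub_mul, mul_one, ← Unitary.coe_star, Unitary.coe_mul_star_self, frameProj,
    Unitary.coe_star]

variable (p) in
lemma one_sub_frameProj_mul_mul_frameProj (B : Matrix ι ι ℝ) (V V' : orthogonalGroup ι ℝ) :
    (1 - frameProj p V) * B * frameProj p V' =
      V * ((1 - coordProj p) * (star (V : Matrix ι ι ℝ) * B * V') * coordProj p) *
        star (V' : Matrix ι ι ℝ) := by
  rw [one_sub_frameProj, frameProj]
  simp only [mul_assoc]

lemma IsSplitInvariant.invariant {B : Matrix ι ι ℝ} {V : orthogonalGroup ι ℝ}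
    (h : IsSplitInvariant p B V) : (1 - frameProj p V) * B * frameProj p V = 0 := by
  obtain ⟨R, C, hu, hR, ⟨M, s, -, rfl, hM, -, -⟩, hB⟩ := h
  have hRR := mul_nonsing_inv R ((isUnit_iff_isUnit_det R).1 hu)
  have conj : star (V : Matrix ι ι ℝ) * B * V = R * (M * diagonal s) * R⁻¹ := by
    calc star (V : Matrix ι ι ℝ) * B * V = star (V : Matrix ι ι ℝ) * (B * (V * R)) * R⁻¹ := by
          simp only [mul_assoc, hRR, mul_one]
      _ = _ := by
          rw [hB, mul_assoc (V : Matrix ι ι ℝ), ← mul_assoc _ (V : Matrix ι ι ℝ),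
            Unitary.coe_star_mul_self, one_mul]
  have hC : (1 - coordProj p) * (M * diagonal s) * coordProj p = 0 :=
    corner_mul_eq_zero hM (corner_eq_zero_of_commute (coordProj_mul_diagonal p s))
  rw [one_sub_frameProj_mul_mul_frameProj, conj,
    corner_mul_eq_zero (corner_mul_eq_zero hR hC) (corner_inv_eq_zero hu hR), mul_zero, zero_mul]

lemma IsSplitInvariant.one_sub_frameProj_mul_frameProj {B : Matrix ι ι ℝ}
    {V V' : orthogonalGroup ι ℝ} (h : IsSplitInvariant p B V) (h' : IsSplitInvariant p B V') :
    (1 - frameProj p V') * frameProj p V = 0 := by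
  obtain ⟨R, C, hu, hR, hC, hB⟩ := h
  obtain ⟨R', C', hu', hR', hC', hB'⟩ := h'
  have hRR := mul_nonsing_inv R ((isUnit_iff_isUnit_det R).1 hu)
  have hR'R' := mul_nonsing_inv R' ((isUnit_iff_isUnit_det R').1 hu')
  have hRR' := nonsing_inv_mul R' ((isUnit_iff_isUnit_det R').1 hu')
  have hV' : (V' : Matrix ι ι ℝ) * star (V' : Matrix ι ι ℝ) = 1 :=
    Unitary.mul_star_self_of_mem V'.2
  set Z := R'⁻¹ * (star (V' : Matrix ι ι ℝ) * V) * R with Z_def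
  have intertwines : Z * C = C' * Z :=
    calc Z * C = R'⁻¹ * star (V' : Matrix ι ι ℝ) * (V * R * C) := by simp only [Z_def, mul_assoc]
      _ = R'⁻¹ * star (V' : Matrix ι ι ℝ) * (B * (V' * (R' * R'⁻¹) * star (V' : Matrix ι ι ℝ)) *
            (V * R)) := by rw [hR'R', mul_one, hV', mul_one, hB]
      _ = R'⁻¹ * star (V' : Matrix ι ι ℝ) * (B * (V' * R')) * Z := by
          simp only [Z_def, mul_assoc]
      _ = R'⁻¹ * (star (V' : Matrix ι ι ℝ) * V') * R' * C' * Z := by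
          rw [hB']
          simp only [mul_assoc]
      _ = C' * Z := by rw [Unitary.coe_star_mul_self, mul_one, hRR', one_mul]
  have hVV : star (V' : Matrix ι ι ℝ) * 1 * V = R' * Z * R⁻¹ := by
    simp only [Z_def, ← mul_assoc, hR'R', mul_one, one_mul]
    rw [mul_assoc _ R, hRR, mul_one]
  rw [← mul_one (1 - frameProj p V'), one_sub_frameProj_mul_mul_frameProj, hVV,
    corner_mul_eq_zero
      (corner_mul_eq_zero hR' (corner_eq_zero_of_intertwines hC hC' intertwines))
      (corner_inv_eq_zero hu hR), mul_zero, zero_mul]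

variable (p) in
lemma isStarProjection_frameProj (V : orthogonalGroup ι ℝ) :
    IsStarProjection (frameProj p V) := by
  have hP := isStarProjection_coordProj p
  constructor
  · rw [IsIdempotentElem, frameProj, mul_assoc, ← mul_assoc (star _), ← mul_assoc (star _),
      Unitary.coe_star_mul_self, one_mul, ← mul_assoc, mul_assoc (V : Matrix ι ι ℝ),
      coordProj_mul_self]
  · exact hP.isSelfAdjoint.conjugate _

lemma IsSplitInvariant.frameProj_eq {B : Matrix ι ι ℝ} {V V' : orthogonalGroup ι ℝ}
    (h : IsSplitInvariant p B V) (h' : IsSplitInvariant p B V') :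
    frameProj p V = frameProj p V' := by
  have h₁ := h.one_sub_frameProj_mul_frameProj h'
  have h₂ := congrArg star (h'.one_sub_frameProj_mul_frameProj h)
  rw [star_mul, star_zero, (isStarProjection_frameProj p V').isSelfAdjoint.star_eq,
    (isStarProjection_frameProj p V).one_sub.isSelfAdjoint.star_eq, mul_sub, mul_one,
    sub_eq_zero] at h₂
  rw [sub_mul, one_mul, sub_eq_zero] at h₁
  exact (h₂.trans h₁.symm).symm

variable (p) in
lemma trace_frameProj (V : orthogonalGroup ι ℝ) : (frameProj p V).trace = (coordProj p).trace := by
  rw [frameProj, trace_mul_comm, ← mul_assoc, Unitary.coe_star_mul_self, one_mul]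

lemma norm_frameProj_sub_le {X R : Matrix ι ι ℝ} {V V' : orthogonalGroup ι ℝ}
    (Xe : X * coordProj p = X) (hR : (1 - coordProj p) * R * coordProj p = 0)
    (h : V * (1 + X) = V' * R) : ‖frameProj p V' - frameProj p V‖ ≤ 2 * ‖X‖ := by
  have hVR : star (V' : Matrix ι ι ℝ) * V * (1 + X) = R := by
    rw [mul_assoc, h, ← mul_assoc, Unitary.coe_star_mul_self, one_mul]
  have corner : (1 - coordProj p) * (star (V' : Matrix ι ι ℝ) * 1 * V) * coordProj p =
      -((1 - coordProj p) * (star (V' : Matrix ι ι ℝ) * V * X)) := by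
    rw [eq_neg_iff_add_eq_zero, ← hR, ← hVR, mul_one, mul_add, mul_one, mul_add, add_mul,
      mul_assoc _ (_ * X), mul_assoc _ X, Xe]
  have hX : ‖(1 - frameProj p V') * frameProj p V‖ ≤ ‖X‖ := by
    rw [← mul_one (1 - frameProj p V'), one_sub_frameProj_mul_mul_frameProj, corner,
      ← Unitary.coe_star (U := V), frobenius_norm_mul_orthogonal, frobenius_norm_orthogonal_mul,
      norm_neg]
    refine (frobenius_norm_proj_mul_le (isStarProjection_coordProj p).one_sub _).trans_eq ?_
    rw [mul_assoc, ← Unitary.coe_star, frobenius_norm_orthogonal_mul, frobenius_norm_orthogonal_mul]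
  have sq_eq := frobenius_norm_proj_sub_proj_sq (isStarProjection_frameProj p V')
    (isStarProjection_frameProj p V) (by rw [trace_frameProj, trace_frameProj])
  refine abs_le_of_sq_le_sq' ?_ (by positivity) |>.2
  nlinarith [norm_nonneg ((1 - frameProj p V') * frameProj p V)]

lemma frameProj_mul_of_commute {V K : orthogonalGroup ι ℝ}
    (hK : Commute (coordProj p) (K : Matrix ι ι ℝ)) : frameProj p (V * K) = frameProj p V := by
  rw [frameProj, frameProj, Submonoid.coe_mul, star_mul, mul_assoc (V : Matrix ι ι ℝ), ← hK.eq]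
  simp only [← mul_assoc]
  rw [mul_assoc _ (K : Matrix ι ι ℝ), ← Unitary.coe_star, Unitary.coe_mul_star_self, mul_one]

variable (p) in
lemma exists_eq_orthogonal_mul_corner_eq_zero {M : Matrix ι ι ℝ} (hM : IsUnit M) :
    ∃ (V : orthogonalGroup ι ℝ) (R : Matrix ι ι ℝ), IsUnit R ∧
      (1 - coordProj p) * R * coordProj p = 0 ∧ M = V * R := by
  obtain ⟨K, V, L, s, -, hK, -, Le, hMK⟩ := exists_block_qr p hM
  have hP := isStarProjection_coordProj p
  have hK' : Commute (coordProj p) (star (K : Matrix ι ι ℝ)) := by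
    simpa only [hP.isSelfAdjoint.star_eq] using hK.star_star
  have hL : (1 - coordProj p) * (1 + L) * coordProj p = 0 := by
    rw [mul_assoc, add_mul, one_mul, Le, add_zero, hP.one_sub_mul_self]
  have hMR : M = V * ((1 + L) * diagonal s * star (K : Matrix ι ι ℝ)) := by
    rw [← mul_assoc, ← mul_assoc, ← hMK, mul_assoc, ← Unitary.coe_star,
      Unitary.coe_mul_star_self, mul_one]
  refine ⟨V, _, ?_, corner_mul_eq_zero (corner_mul_eq_zero hL (corner_eq_zero_of_commute
    (coordProj_mul_diagonal p s))) (corner_eq_zero_of_commute hK'), hMR⟩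
  exact (Unitary.isUnit_coe (U := V)).mul_left_iff.1 (hMR ▸ hM)

variable (p) in
lemma exists_isSplitInvariant_near {A : Matrix ι ι ℝ} (hA : IsUnit A) (V₀ : orthogonalGroup ι ℝ) :
    ∃ V W : orthogonalGroup ι ℝ, ∃ r₀ > 0, ∀ r ≤ r₀, ∀ U : orthogonalGroup ι ℝ,
      V⁻¹ * U * W ∈ nearRefl p r → ∃ V' : orthogonalGroup ι ℝ,
        ‖frameProj p V' - frameProj p V₀‖ ≤ r ∧ IsSplitInvariant p (U * A) V' := by
  obtain ⟨K, W, L, s, hs, hK, eL, Le, hAK⟩ :=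
    exists_block_qr p (hA.mul (Unitary.isUnit_coe (U := V₀)))
  have hL := norm_nonneg L
  refine ⟨V₀ * K, W, 1 / (4 * (1 + ‖L‖)), by positivity, fun r hr U hU => ?_⟩
  have hrL : r * (1 + ‖L‖) ≤ 1 / 4 := by
    rw [le_div_iff₀ (by positivity)] at hr
    linarith
  obtain ⟨X, C, Xe, hX, hC, hUX⟩ := exists_shear_isSplit eL Le hs hrL hU
  rw [← frameProj_mul_of_commute hK]
  set V := V₀ * K
  have hr0 : 0 ≤ r := by linarith [norm_nonneg X]
  have one_add_unit : IsUnit (1 + X) := by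
    have : ‖-X‖ < 1 := by rw [norm_neg]; nlinarith
    simpa using isUnit_one_sub_of_norm_lt_one this
  have hunit : IsUnit ((V : Matrix ι ι ℝ) * (1 + X)) := Unitary.isUnit_coe.mul one_add_unit
  obtain ⟨V', R, hu, hR, hVR⟩ := exists_eq_orthogonal_mul_corner_eq_zero p hunit
  refine ⟨V', (norm_frameProj_sub_le Xe hR hVR).trans (by linarith), R, C, hu, hR, hC, ?_⟩
  rw [← hVR]
  calc U * A * (V * (1 + X)) = U * (A * V₀ * K) * (1 + X) := by
        simp only [V, Submonoid.coe_mul, mul_assoc]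
    _ = V * (star (V : Matrix ι ι ℝ) * U * W * (1 + L) * diagonal s * (1 + X)) := by
        simp only [hAK, ← mul_assoc, ← Unitary.coe_star, Unitary.coe_mul_star_self, one_mul]
    _ = V * (1 + X) * C := by
        rw [mul_assoc (V : Matrix ι ι ℝ) (1 + X), ← hUX]
        rfl

end SplitInvariant

section Measure

lemma measure_biUnion_le_card_mul {G κ : Type*} [Group G] [MeasurableSpace G] [MeasurableMul G]
    (μ : Measure G) [μ.IsMulLeftInvariant] {t : Finset κ} {S : κ → Set G} {T : Set G} (g : G)
    (h : ∀ i ∈ t, ∀ a ∈ S i, ∀ b ∈ S i, g * b⁻¹ * a ∈ T) :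
    μ (⋃ i ∈ t, S i) ≤ t.card * μ T := by
  have cell_le (i) (hi : i ∈ t) : μ (S i) ≤ μ T := by
    rcases (S i).eq_empty_or_nonempty with h0 | ⟨b, hb⟩
    · simp only [h0, measure_empty, zero_le]
    · rw [← measure_preimage_mul μ (g * b⁻¹) T]
      exact measure_mono fun a ha => h i hi a ha b hb
  calc μ (⋃ i ∈ t, S i) ≤ ∑ i ∈ t, μ (S i) := measure_biUnion_finset_le _ _
    _ ≤ ∑ _i ∈ t, μ T := Finset.sum_le_sum cell_le
    _ = t.card * μ T := by rw [Finset.sum_const, nsmul_eq_mul]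

lemma measure_preimage_mul_mul {G : Type*} [Group G] [MeasurableSpace G] [MeasurableMul G]
    (μ : Measure G) [μ.IsMulLeftInvariant] [μ.IsMulRightInvariant] (a b : G) (S : Set G) :
    μ ((fun g => a * g * b) ⁻¹' S) = μ S :=
  (measure_preimage_mul μ a ((fun g => g * b) ⁻¹' S)).trans (measure_preimage_mul_right μ b S)

lemma measure_le_mul_measure_biUnion {α β X : Type*} [MeasurableSpace α] [MeasurableSpace β]
    [PseudoMetricSpace X] [TopologicalSpace.SeparableSpace X] {μ : Measure α} {ν : Measure β}
    {C : ℝ≥0∞} {t : Set α} {x : α → X} {r : α → ℝ} {R : ℝ} {E : α → Set β}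
    (hr : ∀ a ∈ t, 0 < r a) (hR : ∀ a ∈ t, r a ≤ R) (hE : ∀ a ∈ t, MeasurableSet (E a))
    (hμ : ∀ a ∈ t, μ {b | dist (x b) (x a) ≤ 5 * r a} ≤ C * ν (E a))
    (hdisj : ∀ a ∈ t, ∀ b ∈ t, Disjoint (Metric.closedBall (x a) (r a))
      (Metric.closedBall (x b) (r b)) → Disjoint (E a) (E b)) :
    μ t ≤ C * ν (⋃ a ∈ t, E a) := by
  obtain ⟨u, hut, hu, hcov⟩ := Vitali.exists_disjoint_subfamily_covering_enlargement_closedBall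
    t x r R hR 5 (by norm_num)
  have u_countable : u.Countable := hu.countable_of_nonempty_interior fun a ha =>
    ⟨x a, Metric.ball_subset_interior_closedBall (Metric.mem_ball_self (hr a (hut ha)))⟩
  have t_subset : t ⊆ ⋃ a ∈ u, {b | dist (x b) (x a) ≤ 5 * r a} := fun b hb => by
    obtain ⟨a, ha, hsub⟩ := hcov b hb
    exact Set.mem_biUnion ha (hsub (Metric.mem_closedBall_self (hr b hb).le))
  calc μ t ≤ ∑' a : u, μ {b | dist (x b) (x a) ≤ 5 * r a} :=
        (measure_mono t_subset).trans (measure_biUnion_le _ u_countable _)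
    _ ≤ ∑' a : u, C * ν (E a) := ENNReal.tsum_le_tsum fun a => hμ a (hut a.2)
    _ = C * ν (⋃ a ∈ u, E a) := by
        rw [ENNReal.tsum_mul_left, measure_biUnion u_countable (fun a ha b hb hab =>
          hdisj a (hut ha) b (hut hb) (hu ha hb hab)) fun a ha => hE a (hut ha)]
    _ ≤ C * ν (⋃ a ∈ t, E a) := by
        gcongr C * ν ?_
        exact Set.biUnion_subset_biUnion_left hut

lemma lintegral_eq_lintegral_measure_ofReal_lt {α : Type*} [MeasurableSpace α] (μ : Measure α)
    [SFinite μ] {f : α → ℝ≥0∞} (hf : Measurable f) :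
    ∫⁻ a, f a ∂μ = ∫⁻ t in Set.Ioi (0 : ℝ), μ {a | ENNReal.ofReal t < f a} := by
  have hS : MeasurableSet {q : α × ℝ | ENNReal.ofReal q.2 < f q.1} :=
    measurableSet_lt (ENNReal.measurable_ofReal.comp measurable_snd) (hf.comp measurable_fst)
  have volume_eq (c : ℝ≥0∞) : volume.restrict (Set.Ioi 0) {t : ℝ | ENNReal.ofReal t < c} = c := by
    rw [Measure.restrict_apply (measurableSet_lt ENNReal.measurable_ofReal measurable_const)]
    rcases eq_or_ne c ⊤ with rfl | hc
    · simp
    · have : {t : ℝ | ENNReal.ofReal t < c} ∩ Set.Ioi 0 = Set.Ioo 0 c.toReal := by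
        ext t
        rw [Set.inter_comm]
        exact and_congr_right fun ht => ENNReal.ofReal_lt_iff_lt_toReal (le_of_lt ht) hc
      rw [this, Real.volume_Ioo, sub_zero, ENNReal.ofReal_toReal hc]
  calc ∫⁻ a, f a ∂μ
      = (μ.prod (volume.restrict (Set.Ioi 0))) {q : α × ℝ | ENNReal.ofReal q.2 < f q.1} := by
        rw [Measure.prod_apply hS]
        exact lintegral_congr fun a => (volume_eq (f a)).symm
    _ = ∫⁻ t in Set.Ioi (0 : ℝ), μ {a | ENNReal.ofReal t < f a} := Measure.prod_apply_symm hS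

lemma lintegral_le_mul_lintegral_of_measure_lt_le {α β : Type*} [MeasurableSpace α]
    [MeasurableSpace β] {μ : Measure α} {ν : Measure β} [SFinite μ] [SFinite ν] {f : α → ℝ≥0∞}
    {F : β → ℝ≥0∞} (hf : Measurable f) (hF : Measurable F) {C : ℝ≥0}
    (h : ∀ t, μ {a | t < f a} ≤ C * ν {b | t < F b}) :
    ∫⁻ a, f a ∂μ ≤ C * ∫⁻ b, F b ∂ν := by
  rw [lintegral_eq_lintegral_measure_ofReal_lt μ hf, lintegral_eq_lintegral_measure_ofReal_lt ν hF,
    ← lintegral_const_mul' _ _ ENNReal.coe_ne_top]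
  exact lintegral_mono fun t => h _

lemma upperSemicontinuous_iSup_mem {X Y : Type*} [TopologicalSpace X] [CompactSpace X]
    [TopologicalSpace Y] {S : Set (Y × X)} (hS : IsClosed S) {f : Y × X → ℝ≥0∞}
    (hf : Continuous f) : UpperSemicontinuous fun y => ⨆ (x) (_ : (y, x) ∈ S), f (y, x) := by
  intro y c hy
  obtain ⟨d, hyd, hdc⟩ := exists_between hy
  have closed : IsClosed (Prod.fst '' (S ∩ {q | d ≤ f q})) :=
    isClosedMap_fst_of_compactSpace _ (hS.inter (isClosed_le continuous_const hf))
  have not_mem : y ∉ Prod.fst '' (S ∩ {q | d ≤ f q}) := by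
    rintro ⟨⟨_, x⟩, ⟨hx, hd⟩, rfl⟩
    exact (hyd.trans_le hd).not_ge (le_iSup₂_of_le (f := fun x _ => f (_, x)) x hx le_rfl)
  filter_upwards [closed.isOpen_compl.mem_nhds not_mem] with z hz
  refine (iSup₂_le fun x hx => ?_).trans_lt hdc
  by_contra! hlt
  exact hz ⟨(z, x), ⟨hx, hlt.le⟩, rfl⟩

end Measure

section Haar

variable {n : ℕ}

instance instIsHaarMeasureHaarO : (haarO n).IsHaarMeasure := by
  unfold haarO; infer_instance

instance instIsMulRightInvariantHaarO : (haarO n).IsMulRightInvariant := by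
  refine ⟨fun g => ?_⟩
  have : IsProbabilityMeasure ((haarO n).map (· * g)) :=
    Measure.isProbabilityMeasure_map (measurable_mul_const g).aemeasurable
  exact Measure.isHaarMeasure_eq_of_isProbabilityMeasure _ _

variable (p : Fin n → Prop) [DecidablePred p]

lemma continuous_frameProj : Continuous (frameProj p) := by
  unfold frameProj; fun_prop

lemma frameProj_mul (U V : O n) : frameProj p (U * V) = U * frameProj p V * (star U : O n) := by
  simp only [frameProj, Submonoid.coe_mul, star_mul, mul_assoc, Unitary.coe_star]

lemma frameProj_coordRefl : frameProj p (coordRefl p) = coordProj p := by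
  have commute : Commute (coordProj p) (coordRefl p : Matrix (Fin n) (Fin n) ℝ) :=
    ((Commute.ofNat_right _ 2).mul_right (Commute.refl _)).sub_right (Commute.one_right _)
  simpa [frameProj] using frameProj_mul_of_commute (V := 1) commute

open scoped Matrix.Norms.Frobenius

lemma isClosed_nearRefl (r : ℝ) : IsClosed (nearRefl p r) := by
  have hc := continuous_frameProj p
  have h₁ : Continuous fun U : O n => ‖(U : Matrix (Fin n) (Fin n) ℝ) - coordRefl p‖ := by fun_prop
  have h₂ : Continuous fun U : O n => ‖frameProj p U - coordProj p‖ := by fun_prop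
  exact (isClosed_le h₁ continuous_const).inter (isClosed_le h₂ continuous_const)

lemma mul_mem_nearRefl {U V : O n} {r : ℝ} (hUV : ‖(U : Matrix (Fin n) (Fin n) ℝ) - V‖ ≤ 1 / 16)
    (hP : ‖frameProj p U - frameProj p V‖ ≤ r / 16) :
    coordRefl p * V⁻¹ * U ∈ nearRefl p r := by
  generalize hG : coordRefl p * V⁻¹ = G
  have hGV : coordRefl p = G * V := by rw [← hG, inv_mul_cancel_right]
  constructor
  · rwa [hGV, Submonoid.coe_mul, Submonoid.coe_mul, ← mul_sub, frobenius_norm_orthogonal_mul]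
  · rwa [← frameProj_coordRefl, hGV, frameProj_mul, frameProj_mul, ← sub_mul, ← mul_sub,
      frobenius_norm_mul_orthogonal, frobenius_norm_orthogonal_mul]

variable (n) in
lemma exists_haarO_le_mul_nearRefl : ∃ C : ℝ≥0, ∀ (p : Fin n → Prop) [DecidablePred p], ∀ r > 0,
    ∀ Q : Matrix (Fin n) (Fin n) ℝ,
      haarO n {U | dist (frameProj p U) Q ≤ 5 * r} ≤ C * haarO n (nearRefl p r) := by
  obtain ⟨t, -, ht, hcov⟩ := finite_cover_balls_of_compact
    ((isCompact_closedBall (0 : Matrix (Fin n) (Fin n) ℝ) 5).prod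
      (isCompact_closedBall (0 : Matrix (Fin n) (Fin n) ℝ) ‖(1 : Matrix (Fin n) (Fin n) ℝ)‖))
    (e := 1 / 32) (by norm_num)
  lift t to Finset (Matrix (Fin n) (Fin n) ℝ × Matrix (Fin n) (Fin n) ℝ) using ht
  refine ⟨t.card, fun p _ r hr Q => ?_⟩
  set F : O n → Matrix (Fin n) (Fin n) ℝ × Matrix (Fin n) (Fin n) ℝ :=
    fun U => (r⁻¹ • (frameProj p U - Q), U)
  have cover : {U : O n | dist (frameProj p U) Q ≤ 5 * r} ⊆
      ⋃ c ∈ t, F ⁻¹' Metric.ball c (1 / 32) := by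
    intro U hU
    have hF : F U ∈ Metric.closedBall 0 5 ×ˢ
        Metric.closedBall 0 ‖(1 : Matrix (Fin n) (Fin n) ℝ)‖ := by
      constructor
      · rw [mem_closedBall_zero_iff, norm_smul, norm_inv, Real.norm_of_nonneg hr.le,
          inv_mul_le_iff₀ hr, mul_comm, ← dist_eq_norm]
        exact hU
      · rw [mem_closedBall_zero_iff, ← frobenius_norm_orthogonal_mul U 1, mul_one]
    simpa only [Set.mem_iUnion, Set.mem_preimage, Finset.mem_coe] using hcov hF
  refine (measure_mono cover).trans (measure_biUnion_le_card_mul _ (coordRefl p) ?_)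
  intro c _ U hU V hV
  have hUV : dist (F U) (F V) ≤ 1 / 16 :=
    (dist_triangle_right _ _ c).trans (by linarith [Metric.mem_ball.1 hU, Metric.mem_ball.1 hV])
  obtain ⟨hP, hd⟩ := max_le_iff.1 hUV
  refine mul_mem_nearRefl p ((dist_eq_norm _ _).symm.trans_le hd) ?_
  rw [dist_eq_norm, ← smul_sub, sub_sub_sub_cancel_right, norm_smul, norm_inv,
    Real.norm_of_nonneg hr.le, inv_mul_le_iff₀ hr] at hP
  linarith

end Haar

section Grassmannian

variable {n k : ℕ}

/-- The orthogonal projection of `ℝⁿ` onto `g`, which encodes the topology of `G(n,k)`. -/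
def Grass.proj (g : Grass n k) : E n →L[ℝ] E n := g.1.starProjection

lemma Grass.continuous_proj : Continuous (Grass.proj : Grass n k → E n →L[ℝ] E n) :=
  continuous_induced_dom

/-- The set of the first `k` of `n` coordinates, which span `Grass.base`. -/
abbrev firstCoords (n k : ℕ) : Fin n → Prop := fun i => (i : ℕ) < k

lemma continuous_toEuclideanCLM : Continuous fun M : Matrix (Fin n) (Fin n) ℝ =>
    (toEuclideanCLM (𝕜 := ℝ) M : E n →L[ℝ] E n) :=
  (toEuclideanCLM (𝕜 := ℝ) (n := Fin n)).toAlgEquiv.toLinearMap.continuous_of_finiteDimensional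

lemma toEuclideanCLM_coordProj_single (p : Fin n → Prop) [DecidablePred p] (i : Fin n) :
    toEuclideanCLM (𝕜 := ℝ) (coordProj p) (EuclideanSpace.single i 1) =
      if p i then EuclideanSpace.single i (1 : ℝ) else 0 := by
  ext j
  rw [ofLp_toEuclideanCLM, coordProj, mulVec_diagonal]
  by_cases hij : j = i
  · subst hij; by_cases hj : p j <;> simp [hj]
  · by_cases hi : p i <;> simp [hi, hij]

lemma Grass.base_eq_range (hk : k ≤ n) : (Grass.base hk).1 = LinearMap.range
    (toEuclideanCLM (𝕜 := ℝ) (coordProj (firstCoords n k))).toLinearMap := by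
  have hb := (EuclideanSpace.basisFun (Fin n) ℝ).toBasis.span_eq
  rw [LinearMap.range_eq_map, ← hb, Submodule.map_span, ← Set.range_comp]
  apply le_antisymm <;> rw [Grass.base, Submodule.span_le]
  · rintro _ ⟨i, rfl⟩
    refine Submodule.subset_span ⟨Fin.castLE hk i, ?_⟩
    simpa using toEuclideanCLM_coordProj_single (firstCoords n k) (Fin.castLE hk i)
  · rintro _ ⟨i, rfl⟩
    have h := toEuclideanCLM_coordProj_single (firstCoords n k) i
    split_ifs at h with hi
    · exact Submodule.subset_span ⟨⟨i, hi⟩, by simpa using h.symm⟩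
    · simp [h]

lemma Grass.proj_smul_base (hk : k ≤ n) (V : O n) : (O.toGL V • Grass.base hk).proj =
    toEuclideanCLM (𝕜 := ℝ) (frameProj (firstCoords n k) V) := by
  set p := firstCoords n k
  obtain ⟨_, hrange⟩ := isStarProjection_iff_eq_starProjection_range.1
    ((isStarProjection_frameProj p V).map (toEuclideanCLM (𝕜 := ℝ) (n := Fin n)))
  have surjective : Function.Surjective
      (toEuclideanCLM (𝕜 := ℝ) (star (V : Matrix (Fin n) (Fin n) ℝ)) : E n →L[ℝ] E n) := fun x =>
    ⟨toEuclideanCLM (𝕜 := ℝ) V.1 x, by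
      rw [← mul_apply_eq_comp, ← map_mul, Unitary.coe_star_mul_self, map_one,
        one_apply_eq_self]⟩
  rw [hrange]
  refine Submodule.starProjection_inj.2 ?_
  calc (O.toGL V • Grass.base hk).1
    _ = (Grass.base hk).1.map (toEuclideanCLM (𝕜 := ℝ) V.1 : E n →ₗ[ℝ] E n) := rfl
    _ = _ := by
      rw [base_eq_range, ← LinearMap.range_comp, frameProj, map_mul, map_mul]
      exact (LinearMap.range_comp_of_range_eq_top _ (LinearMap.range_eq_top.2 surjective)).symm

lemma Grass.smul_eq_self_iff (A : GL (Fin n) ℝ) (g : Grass n k) :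
    A • g = g ↔ (1 - g.proj) * toEuclideanCLM (𝕜 := ℝ) A.1 * g.proj = 0 := by
  have le_iff : A • g = g ↔ g.1.map (euclMap A) ≤ g.1 := by
    refine ⟨fun h => (congrArg Subtype.val h).le, fun h => ?_⟩
    exact Subtype.ext (Submodule.eq_of_le_of_finrank_eq h ((A • g).2.trans g.2.symm))
  have apply_eq_zero_iff (x : E n) :
      ((1 - g.proj) * toEuclideanCLM (𝕜 := ℝ) A.1 * g.proj) x = 0 ↔ euclMap A (g.proj x) ∈ g.1 :=
    sub_eq_zero.trans (eq_comm.trans g.1.starProjection_eq_self_iff)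
  rw [le_iff, Submodule.map_le_iff_le_comap, ContinuousLinearMap.ext_iff]
  refine ⟨fun h x => (apply_eq_zero_iff x).2 (h (g.1.starProjection_apply_mem x)),
    fun h x hx => ?_⟩
  have hx' : g.proj x = x := g.1.starProjection_eq_self_iff.2 hx
  rw [← hx']
  exact (apply_eq_zero_iff x).1 (h x)

lemma Grass.isClosed_setOf_smul_eq_self :
    IsClosed {q : GL (Fin n) ℝ × Grass n k | q.1 • q.2 = q.2} := by
  have hP : Continuous fun q : GL (Fin n) ℝ × Grass n k => q.2.proj :=
    continuous_proj.comp continuous_snd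
  have hA : Continuous fun q : GL (Fin n) ℝ × Grass n k => toEuclideanCLM (𝕜 := ℝ) q.1.1 :=
    continuous_toEuclideanCLM.comp (Units.continuous_val.comp continuous_fst)
  simp only [smul_eq_self_iff]
  exact isClosed_eq (((continuous_const.sub hP).mul hA).mul hP) continuous_const

lemma absDet_eq_sqrt_det (A : GL (Fin n) ℝ) (g : Grass n k) : absDet A g =
    √(1 - g.proj + g.proj * toEuclideanCLM (𝕜 := ℝ) (star A.1 * A.1) * g.proj).det := by
  set F : E n →L[ℝ] E n := 1 - g.proj + g.proj * toEuclideanCLM (𝕜 := ℝ) (star A.1 * A.1) * g.proj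
  have proj_eq_self (x : g.1) : g.proj x = x := g.1.starProjection_eq_self_iff.2 x.2
  have F_apply (x : g.1) : F x = g.proj (toEuclideanCLM (𝕜 := ℝ) (star A.1 * A.1) x) := by
    simp [F, proj_eq_self]
  have hF : g.1 ≤ g.1.comap F.toLinearMap := fun x hx => by
    change F x ∈ g.1
    rw [F_apply ⟨x, hx⟩]
    exact g.1.starProjection_apply_mem _
  have restrict_eq : F.toLinearMap.restrict hF =
      LinearMap.adjoint ((euclMap A).domRestrict g.1) ∘ₗ (euclMap A).domRestrict g.1 := by
    refine LinearMap.ext fun x => ext_inner_right ℝ fun y => ?_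
    rw [LinearMap.comp_apply, LinearMap.adjoint_inner_left]
    change inner ℝ (F x) (y : E n) =
      inner ℝ (toEuclideanCLM (𝕜 := ℝ) A.1 x) (toEuclideanCLM (𝕜 := ℝ) A.1 y)
    rw [F_apply, Grass.proj, Submodule.inner_starProjection_left_eq_right, ← Grass.proj,
      proj_eq_self, map_mul, map_star, mul_apply_eq_comp]
    exact ContinuousLinearMap.adjoint_inner_left _ _ _
  have mapQ_eq : g.1.mapQ g.1 F.toLinearMap hF = LinearMap.id := by
    refine Submodule.linearMap_qext _ (LinearMap.ext fun x => ?_)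
    refine (Submodule.Quotient.eq _).2 ?_
    have F_sub (x : E n) : F x - x =
        g.proj (toEuclideanCLM (𝕜 := ℝ) (star A.1 * A.1) (g.proj x) - x) := by
      rw [map_sub]
      change x - g.proj x + g.proj (toEuclideanCLM (𝕜 := ℝ) (star A.1 * A.1) (g.proj x)) - x = _
      abel
    exact F_sub x ▸ g.1.starProjection_apply_mem _
  rw [absDet, ← restrict_eq, ContinuousLinearMap.det, LinearMap.det_eq_det_mul_det g.1 _ hF,
    mapQ_eq, LinearMap.det_id, mul_one]

lemma continuous_absDet : Continuous fun q : GL (Fin n) ℝ × Grass n k => absDet q.1 q.2 := by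
  have hP : Continuous fun q : GL (Fin n) ℝ × Grass n k => q.2.proj :=
    Grass.continuous_proj.comp continuous_snd
  have hA : Continuous fun q : GL (Fin n) ℝ × Grass n k =>
      toEuclideanCLM (𝕜 := ℝ) (star q.1.1 * q.1.1) :=
    have h := Units.continuous_val.comp continuous_fst
    continuous_toEuclideanCLM.comp (h.star.mul h)
  simp only [absDet_eq_sqrt_det]
  exact (ContinuousLinearMap.continuous_det.comp
    ((continuous_const.sub hP).add ((hP.mul hA).mul hP))).sqrt

lemma continuous_logPlusDet :
    Continuous fun q : GL (Fin n) ℝ × Grass n k => logPlusDet q.1 q.2 :=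
  ENNReal.continuous_ofReal.comp (continuous_posLog.comp continuous_absDet)

lemma logPlusDet_toGL_mul (U : O n) (A : GL (Fin n) ℝ) (g : Grass n k) :
    logPlusDet (O.toGL U * A) g = logPlusDet A g := by
  have h : star ((O.toGL U * A : GL (Fin n) ℝ) : Matrix (Fin n) (Fin n) ℝ) *
      (O.toGL U * A : GL (Fin n) ℝ) = star A.1 * A.1 := by
    change star (U.1 * A.1) * (U.1 * A.1) = _
    rw [star_mul, mul_assoc, ← mul_assoc _ U.1, Unitary.coe_star_mul_self, one_mul]
  rw [logPlusDet, logPlusDet, absDet_eq_sqrt_det, absDet_eq_sqrt_det, h]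

lemma Grass.exists_toGL_smul_base_eq (hk : k ≤ n) (g : Grass n k) :
    ∃ U : O n, O.toGL U • Grass.base hk = g := by
  have dim_eq : Module.finrank ℝ (Grass.base hk).1 = Module.finrank ℝ g.1 :=
    (Grass.base hk).2.trans g.2.symm
  let φ : (Grass.base hk).1 ≃ₗᵢ[ℝ] g.1 :=
    (stdOrthonormalBasis ℝ _).equiv (stdOrthonormalBasis ℝ _) (finCongr dim_eq)
  let L := g.1.subtypeₗᵢ.comp φ.toLinearIsometry
  let f : unitary (E n →L[ℝ] E n) :=
    Unitary.linearIsometryEquiv.symm (L.extend.toLinearIsometryEquiv rfl)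
  let U : O n := ⟨(toEuclideanCLM (𝕜 := ℝ)).symm f.1,
    Unitary.map_mem (toEuclideanCLM (𝕜 := ℝ) (n := Fin n)).symm f.2⟩
  refine ⟨U, Subtype.ext (Submodule.eq_of_le_of_finrank_eq ?_
    ((O.toGL U • Grass.base hk).2.trans g.2.symm))⟩
  rintro _ ⟨x, hx, rfl⟩
  have : euclMap (O.toGL U) x = φ ⟨x, hx⟩ := by
    change toEuclideanCLM (𝕜 := ℝ) ((toEuclideanCLM (𝕜 := ℝ)).symm f.1) x = _
    rw [StarAlgEquiv.apply_symm_apply]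
    exact L.extend_apply ⟨x, hx⟩
  rw [this]
  exact (φ ⟨x, hx⟩).2

lemma Grass.compactSpace (hk : k ≤ n) : CompactSpace (Grass n k) := by
  have : Set.range (fun U : O n => O.toGL U • Grass.base hk) = Set.univ :=
    Set.range_eq_univ.2 (exists_toGL_smul_base_eq hk)
  exact ⟨this ▸ isCompact_range (continuous_orbit _)⟩

end Grassmannian

section Covering

variable {n k : ℕ}

open scoped Matrix.Norms.Frobenius

lemma Grass.exists_frameProj_near_smul_base_mem (hk : k ≤ n) {Ω : Set (Grass n k)}
    (hΩ : IsOpen Ω) {V₀ : O n} (hV₀ : O.toGL V₀ • Grass.base hk ∈ Ω) :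
    ∃ δ > 0, ∀ V : O n,
      ‖frameProj (firstCoords n k) V - frameProj (firstCoords n k) V₀‖ ≤ δ →
        O.toGL V • Grass.base hk ∈ Ω := by
  obtain ⟨T, hT, rfl⟩ := isOpen_induced_iff.1 hΩ
  have hmem (V : O n) : O.toGL V • Grass.base hk ∈ (fun g : Grass n k => g.1.starProjection) ⁻¹' T ↔
      toEuclideanCLM (𝕜 := ℝ) (frameProj (firstCoords n k) V) ∈ T := by
    rw [← proj_smul_base hk]; rfl
  obtain ⟨δ, hδ, h⟩ := Metric.nhds_basis_closedBall.mem_iff.1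
    ((hT.preimage continuous_toEuclideanCLM).mem_nhds ((hmem V₀).1 hV₀))
  exact ⟨δ, hδ, fun V hV => (hmem V).2 (h (mem_closedBall_iff_norm.2 hV))⟩

lemma exists_isSplitInvariant_smul_base_mem (hk : k ≤ n) (A : GL (Fin n) ℝ) {Ω : Set (Grass n k)}
    (hΩ : IsOpen Ω) {V₀ : O n} (hV₀ : O.toGL V₀ • Grass.base hk ∈ Ω) :
    ∃ V W : O n, ∃ r, 0 < r ∧ r ≤ 1 ∧ ∀ U : O n,
      V⁻¹ * U * W ∈ nearRefl (firstCoords n k) r → ∃ V' : O n,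
        ‖frameProj (firstCoords n k) V' - frameProj (firstCoords n k) V₀‖ ≤ r ∧
          IsSplitInvariant (firstCoords n k) (U * A.1) V' ∧
            O.toGL V' • Grass.base hk ∈ Ω := by
  obtain ⟨δ, hδ, mem_of_near⟩ := Grass.exists_frameProj_near_smul_base_mem hk hΩ hV₀
  obtain ⟨V, W, r₀, hr₀, h⟩ := exists_isSplitInvariant_near (firstCoords n k) A.isUnit V₀
  refine ⟨V, W, min r₀ (min δ 1), by positivity, by simp, fun U hU => ?_⟩
  obtain ⟨V', near, invariant⟩ := h _ (min_le_left _ _) U hU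
  exact ⟨V', near, invariant, mem_of_near V' (near.trans (inf_le_right.trans inf_le_left))⟩

lemma IsSplitInvariant.smul_eq_self (hk : k ≤ n) {B : GL (Fin n) ℝ} {V : O n}
    (h : IsSplitInvariant (firstCoords n k) B.1 V) :
    B • O.toGL V • Grass.base hk = O.toGL V • Grass.base hk := by
  rw [Grass.smul_eq_self_iff, Grass.proj_smul_base, ← map_one (toEuclideanCLM (𝕜 := ℝ)), ← map_sub,
    ← map_mul, ← map_mul, h.invariant, map_zero]

lemma exists_grassMeasure_le_mul_haarO_fixed (n : ℕ) : ∃ C : ℝ≥0, ∀ (k : ℕ) (hk : k ≤ n)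
    (A : GL (Fin n) ℝ) (Ω : Set (Grass n k)), IsOpen Ω →
      grassMeasure hk Ω ≤ C * haarO n {U | ∃ g ∈ Ω, (O.toGL U * A) • g = g} := by
  obtain ⟨C, hC⟩ := exists_haarO_le_mul_nearRefl n
  refine ⟨C, fun k hk A Ω hΩ => ?_⟩
  let p := firstCoords n k
  let t := {V : O n | O.toGL V • Grass.base hk ∈ Ω}
  choose! V W r r_pos r_le h using
    fun V₀ (hV₀ : V₀ ∈ t) => exists_isSplitInvariant_smul_base_mem hk A hΩ hV₀
  choose! V' near invariant mem using h
  let cell (a : O n) : Set (O n) := (fun U => (V a)⁻¹ * U * W a) ⁻¹' nearRefl p (r a)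
  have hcell (a : O n) : MeasurableSet (cell a) :=
    ((isClosed_nearRefl p (r a)).preimage (by fun_prop)).measurableSet
  have volume_le (a : O n) (ha : a ∈ t) :
      haarO n {b | dist (frameProj p b) (frameProj p a) ≤ 5 * r a} ≤ C * haarO n (cell a) := by
    rw [measure_preimage_mul_mul (haarO n)]
    exact hC p (r a) (r_pos a ha) _
  have disjoint (a : O n) (ha : a ∈ t) (b : O n) (hb : b ∈ t)
      (hab : Disjoint (Metric.closedBall (frameProj p a) (r a))
        (Metric.closedBall (frameProj p b) (r b))) : Disjoint (cell a) (cell b) := by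
    refine Set.disjoint_left.2 fun U hUa hUb => Set.disjoint_left.1 hab
      (mem_closedBall_iff_norm.2 (near a ha U hUa)) ?_
    rw [(invariant a ha U hUa).frameProj_eq (invariant b hb U hUb)]
    exact mem_closedBall_iff_norm.2 (near b hb U hUb)
  calc grassMeasure hk Ω
    _ = haarO n t := Measure.map_apply (continuous_orbit _).measurable hΩ.measurableSet
    _ ≤ C * haarO n (⋃ a ∈ t, cell a) :=
      measure_le_mul_measure_biUnion r_pos r_le (fun a _ => hcell a) volume_le disjoint
    _ ≤ C * haarO n {U | ∃ g ∈ Ω, (O.toGL U * A) • g = g} := by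
      gcongr
      refine Set.iUnion₂_subset fun a ha U hU => ⟨_, mem a ha U hU, ?_⟩
      exact IsSplitInvariant.smul_eq_self hk (invariant a ha U hU)

end Covering

section Averaging

variable {n k : ℕ}

instance instSecondCountableTopologyMatrix :
    SecondCountableTopology (Matrix (Fin n) (Fin n) ℝ) :=
  inferInstanceAs (SecondCountableTopology (Fin n → Fin n → ℝ))

instance instSecondCountableTopologyO : SecondCountableTopology (O n) :=
  Topology.IsEmbedding.subtypeVal.secondCountableTopology

lemma continuous_toGL : Continuous (O.toGL : O n → GL (Fin n) ℝ) :=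
  Units.continuous_iff.2
    ⟨continuous_subtype_val, continuous_star.comp continuous_subtype_val⟩

lemma measurable_toGL_mul : Measurable fun q : GL (Fin n) ℝ × O n => O.toGL q.2 * q.1 :=
  ((continuous_toGL.comp continuous_snd).mul continuous_fst).measurable

lemma IsOrthogonallyInvariant.lintegral_lintegral_toGL_mul {μ : Measure (GL (Fin n) ℝ)} [SFinite μ]
    (hμ : IsOrthogonallyInvariant μ) {F : GL (Fin n) ℝ → ℝ≥0∞} (hF : Measurable F) :
    ∫⁻ A, ∫⁻ U, F (O.toGL U * A) ∂haarO n ∂μ = ∫⁻ A, F A ∂μ := by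
  calc ∫⁻ A, ∫⁻ U, F (O.toGL U * A) ∂haarO n ∂μ
    _ = ∫⁻ U, ∫⁻ A, F (O.toGL U * A) ∂μ ∂haarO n :=
      lintegral_lintegral_swap (hF.comp measurable_toGL_mul).aemeasurable
    _ = ∫⁻ _ : O n, ∫⁻ A, F A ∂μ ∂haarO n := by
      refine lintegral_congr fun U => ?_
      conv_rhs => rw [← hμ U]
      exact (lintegral_map hF (measurable_toGL_mul.comp measurable_prodMk_right)).symm
    _ = ∫⁻ A, F A ∂μ := by simp

/-- The largest `log⁺ |det A|_g|` over the `k`-dimensional subspaces `g` with `A(g) = g`;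
it is `0` if there is no such `g`. -/
def supLogPlusDet (k : ℕ) (A : GL (Fin n) ℝ) : ℝ≥0∞ :=
  ⨆ (g : Grass n k) (_ : A • g = g), logPlusDet A g

lemma measurable_supLogPlusDet (hk : k ≤ n) :
    Measurable (supLogPlusDet k : GL (Fin n) ℝ → ℝ≥0∞) :=
  have := Grass.compactSpace hk
  (upperSemicontinuous_iSup_mem Grass.isClosed_setOf_smul_eq_self
    continuous_logPlusDet).measurable

lemma exists_lintegral_logPlusDet_le (n : ℕ) : ∃ C : ℝ≥0, ∀ (k : ℕ) (hk : k ≤ n)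
    (A : GL (Fin n) ℝ), ∫⁻ g, logPlusDet A g ∂grassMeasure hk ≤
      C * ∫⁻ U, supLogPlusDet k (O.toGL U * A) ∂haarO n := by
  obtain ⟨C, hC⟩ := exists_grassMeasure_le_mul_haarO_fixed n
  refine ⟨C, fun k hk A => ?_⟩
  have hf : Continuous fun g : Grass n k => logPlusDet A g :=
    continuous_logPlusDet.comp (Continuous.prodMk_right A)
  have hF : Measurable fun U : O n => supLogPlusDet k (O.toGL U * A) :=
    (measurable_supLogPlusDet hk).comp (measurable_toGL_mul.comp measurable_prodMk_left)
  refine lintegral_le_mul_lintegral_of_measure_lt_le hf.measurable hF fun t =>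
    (hC k hk A _ (isOpen_lt continuous_const hf)).trans ?_
  gcongr with U
  rintro ⟨g, hg, fixed⟩
  calc t
    _ < logPlusDet A g := hg
    _ = logPlusDet (O.toGL U * A) g := (logPlusDet_toGL_mul U A g).symm
    _ ≤ supLogPlusDet k (O.toGL U * A) :=
      le_iSup₂ (f := fun (g : Grass n k) (_ : (O.toGL U * A) • g = g) =>
        logPlusDet (O.toGL U * A) g) g fixed

end Averaging

end OrthInv

end

theorem theorem3_general (n : ℕ) :
    ∃ c : ℝ≥0, 0 < c ∧
      ∀ (k : ℕ) (hk : k ≤ n) (μ : Measure (GL (Fin n) ℝ)) [SFinite μ],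
        OrthInv.IsOrthogonallyInvariant μ →
          (c : ℝ≥0∞) * ∫⁻ A, ∫⁻ g, OrthInv.logPlusDet A g ∂(OrthInv.grassMeasure hk) ∂μ ≤
            ∫⁻ A, (⨆ (g : OrthInv.Grass n k) (_ : A • g = g), OrthInv.logPlusDet A g) ∂μ := by
  obtain ⟨C, hC⟩ := OrthInv.exists_lintegral_logPlusDet_le n
  refine ⟨(C + 1)⁻¹, by positivity, fun k hk μ _ hμ => ?_⟩
  have hC₁ : C + 1 ≠ 0 := by positivity
  rw [ENNReal.coe_inv hC₁, ENNReal.inv_mul_le_iff (ENNReal.coe_ne_zero.2 hC₁) ENNReal.coe_ne_top]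
  calc ∫⁻ A, ∫⁻ g, OrthInv.logPlusDet A g ∂(OrthInv.grassMeasure hk) ∂μ
    _ ≤ ∫⁻ A, C * ∫⁻ U, OrthInv.supLogPlusDet k (OrthInv.O.toGL U * A) ∂OrthInv.haarO n ∂μ :=
      lintegral_mono fun A => hC k hk A
    _ = C * ∫⁻ A, ∫⁻ U, OrthInv.supLogPlusDet k (OrthInv.O.toGL U * A) ∂OrthInv.haarO n ∂μ :=
      lintegral_const_mul' _ _ ENNReal.coe_ne_top
    _ = C * ∫⁻ A, OrthInv.supLogPlusDet k A ∂μ := by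
      rw [hμ.lintegral_lintegral_toGL_mul (OrthInv.measurable_supLogPlusDet hk)]
    _ ≤ (C + 1 : ℝ≥0) * ∫⁻ A, OrthInv.supLogPlusDet k A ∂μ := by
      gcongr
      exact le_self_add

theorem theorem3 (n : ℕ) :
    ∃ c : ℝ≥0, 0 < c ∧
      ∀ (k : ℕ) (hk : k ≤ n) (μ : Measure (GL (Fin n) ℝ)) [IsProbabilityMeasure μ],
        OrthInv.IsOrthogonallyInvariant μ →
          (c : ℝ≥0∞) * ∫⁻ A, ∫⁻ g, OrthInv.logPlusDet A g ∂(OrthInv.grassMeasure hk) ∂μ ≤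
            ∫⁻ A, (⨆ (g : OrthInv.Grass n k) (_ : A • g = g), OrthInv.logPlusDet A g) ∂μ := by
  obtain ⟨c, hc, h⟩ := theorem3_general n
  exact ⟨c, hc, fun k hk μ _ hμ => h k hk μ hμ⟩
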